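/- For a complex square matrix $A$ let $W(A)=\{\langle Av,v\rangle : \|v\|=1\}$ be its numerical range. A flat portion of $\partial W(A)$ is a nondegenerate line segment contained in $\partial W(A)$ that is maximal under inclusion among such segments. Two flat portions on non-parallel lines $\ell_1,\ell_2$ are said to meet at the angle $\theta$ if $\theta$ is the angle, at the point $s$ with $\ell_1\cap\ell_2=\{s\}$, between the two rays from $s$ through the two flat portions (equivalently, the interior angle at $s$ of the sector bounded by $\ell_1$ and $\ell_2$ that contains $W(A)$). **Theorem 4.1.** Let $\theta\in(0,\pi)$, let $d>0$, put $S=\sin(\theta/2)$ and $C=\cos(\theta/2)$, and let $A$ be a complex $4\times 4$ nilpotent matrix. Then $\partial W(A)$ contains two flat portions on non-parallel lines, each line at distance $d$ from the origin, that meet at the angle $\theta$, if and only if $A$ is unitarily equivalent to a matrix of the form $$e^{it}\begin{pmatrix}0&x&\delta_1&y\\0&0&y&\delta_2\\0&0&0&x\\0&0&0&0\end{pmatrix},$$ where $t\in[0,2\pi)$, $x\in(0,2d)$, $$0<y\le\sqrt{\frac{16d^4-4d^2x^2}{4d^2-x^2S^2}},$$ and $\delta_1,\delta_2$ are, in either order,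 the two numbers $$\frac{1}{2d}\left(xyS\pm\sqrt{x^2y^2S^2+16d^4-4d^2(x^2+y^2)}\right),$$ that is, the two roots (counted with multiplicity) of $d\tau^2-xyS\,\tau+d(x^2+y^2-4d^2)=0$. Furthermore, whenever $A$ is unitarily equivalent to such a matrix, every flat portion of $\partial W(A)$ has length $$L=\frac{8d^3xyC}{16d^4-x^2y^2S^2}.$$ -/

import Mathlib

namespace NilpotentNR

/-- The numerical range `W(A) = {⟨A v, v⟩ : ‖v‖ = 1}` of a complex square matrix. Mathlib's inner
product is conjugate-linear in its first argument, so `inner ℂ v w = ∑ j, w j * conj (v j)`. -/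
def numericalRange {n : Type*} [Fintype n] [DecidableEq n] (A : Matrix n n ℂ) : Set ℂ :=
  {z | ∃ v : EuclideanSpace ℂ n, ‖v‖ = 1 ∧ inner ℂ v (Matrix.toEuclideanLin A v) = z}

/-- `A` and `B` are unitarily equivalent: `A = U B U*` for some unitary matrix `U`. -/
def UnitarilyEquivalent {n : Type*} [Fintype n] [DecidableEq n] (A B : Matrix n n ℂ) : Prop :=
  ∃ U ∈ Matrix.unitaryGroup n ℂ, A = U * B * star U

/-- The segment `[p, q]` is a flat portion on the boundary of the plane set `K`: it is
nondegenerate, is contained in the boundary of `K`, and is not properly contained in a larger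
segment of the boundary. -/
def IsFlatPortion (K : Set ℂ) (p q : ℂ) : Prop :=
  p ≠ q ∧ segment ℝ p q ⊆ frontier K ∧
    ∀ p' q' : ℂ, segment ℝ p q ⊆ segment ℝ p' q' → segment ℝ p' q' ⊆ frontier K →
      segment ℝ p' q' = segment ℝ p q

/-- The lines through the segments `[p₁, q₁]` and `[p₂, q₂]` have a common point `s`, and the
two rays that start at `s` and run through the points of the one and of the other segment form
the angle `θ`. When the segments are flat portions on the boundary of a convex set `K`, these
two rays bound the sector with vertex `s` cut out by the two support lines, which contains `K`. -/
def MeetAtAngle (p₁ q₁ p₂ q₂ : ℂ) (θ : ℝ) : Prop :=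
  ∃ s : ℂ, s ∈ line[ℝ, p₁, q₁] ∧ s ∈ line[ℝ, p₂, q₂] ∧
    ∀ a ∈ segment ℝ p₁ q₁, ∀ b ∈ segment ℝ p₂ q₂, a ≠ s → b ≠ s →
      EuclideanGeometry.angle a s b = θ

/-- The boundary of `K` contains two flat portions on non-parallel lines that both have distance
`d` from the origin and that meet at the angle `θ`. -/
def HasTwoFlatPortions (K : Set ℂ) (d θ : ℝ) : Prop :=
  ∃ p₁ q₁ p₂ q₂ : ℂ, IsFlatPortion K p₁ q₁ ∧ IsFlatPortion K p₂ q₂ ∧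
    ¬ (line[ℝ, p₁, q₁]).Parallel line[ℝ, p₂, q₂] ∧
    Metric.infDist 0 (line[ℝ, p₁, q₁] : Set ℂ) = d ∧
    Metric.infDist 0 (line[ℝ, p₂, q₂] : Set ℂ) = d ∧
    MeetAtAngle p₁ q₁ p₂ q₂ θ

/-- The real upper triangular matrix with parameters `x, y, δ₁, δ₂`, as a complex matrix. -/
def formMatrix (x y δ₁ δ₂ : ℝ) : Matrix (Fin 4) (Fin 4) ℂ :=
  !![0, (x : ℂ), (δ₁ : ℂ), (y : ℂ);
     0, 0, (y : ℂ), (δ₂ : ℂ);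
     0, 0, 0, (x : ℂ);
     0, 0, 0, 0]

/-- `δ = (x y S + ε √(x² y² S² + 16 d⁴ - 4 d² (x² + y²))) / (2 d)` with `S = sin (θ / 2)`; for
`ε = 1` and `ε = -1` these are the two roots (with multiplicity) of
`d t² - x y S t + d (x² + y² - 4 d²)`. -/
noncomputable def deltaRoot (d θ x y ε : ℝ) : ℝ :=
  (x * y * Real.sin (θ / 2) +
    ε * √(x ^ 2 * y ^ 2 * Real.sin (θ / 2) ^ 2 + 16 * d ^ 4 - 4 * d ^ 2 * (x ^ 2 + y ^ 2)))
    / (2 * d)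

/-- The parameters `x, y` lie in the admissible range for `d, θ`, and `A` is unitarily equivalent
to `e^{it}` times the matrix with parameters `x, y, δ₁, δ₂`, where `δ₁, δ₂` are the two roots in
either order. -/
def HasForm (d θ x y : ℝ) (A : Matrix (Fin 4) (Fin 4) ℂ) : Prop :=
  (0 < x ∧ x < 2 * d) ∧
  (0 < y ∧ y ≤ √((16 * d ^ 4 - 4 * d ^ 2 * x ^ 2) /
    (4 * d ^ 2 - x ^ 2 * Real.sin (θ / 2) ^ 2))) ∧
  ∃ t δ₁ δ₂ : ℝ, (0 ≤ t ∧ t < 2 * Real.pi) ∧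
    ((δ₁ = deltaRoot d θ x y 1 ∧ δ₂ = deltaRoot d θ x y (-1)) ∨
      (δ₁ = deltaRoot d θ x y (-1) ∧ δ₂ = deltaRoot d θ x y 1)) ∧
    UnitarilyEquivalent A (Complex.exp (t * Complex.I) • formMatrix x y δ₁ δ₂)

end NilpotentNR

/-! The line `Re (z w) = -k/2` supports `W(A)` exactly when the Hermitian pencil `H = k + zA + z̄A*`
is positive semidefinite and singular, and the contact set is the set of values of `⟨Av,v⟩` at unit
vectors of `ker H`. A flat portion therefore forces `dim ker H ≥ 2`, so all 3×3 minors of the 4×4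
matrix `H` vanish. By Toeplitz–Hausdorff `W(A)` is convex and compact, so flat portions are the
nondegenerate faces cut out by support lines; since `0 ∈ W(A)`, distance `d` means `k = 2d`.

Necessity. A rotation makes the two unit normals `ω` and `ω̄`, with `ω = S + iC`. With `A` strictly
upper triangular (Schur), the minors used in `upper_minors` are, up to a phase, affine in `z` and
`z̄`. Imposing the off-diagonal ones at both `ω` and `ω̄` separates coefficients
(`eq_of_linear_pair`). Once the superdiagonal is made positive by a diagonal unitary, these
relations force the symmetric real shape of the matrix, with `k(δ₁+δ₂) = 2Sxy`; a principal minor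
gives `δ₁δ₂ = x²+y²-k²`. Reality of `δ₁, δ₂` is the bound on `y`.

Sufficiency. Under these two relations the pencil of the model matrix at a unit `ω` with `Re ω = S`
is a sum of two squares (`quad_pencil_formMatrix`), hence positive semidefinite of rank 2. On its
two-dimensional kernel the position along the support line is governed by two Hermitian forms `E`,
`F` for which `E - F` and `E + F` are nonnegative of rank one (`FormParams.kernelVec_values`). The
extreme positions are thus reached at `F = E` and `F = -E`, which gives the length.

Every flat portion. The same minors, applied to the model matrix in an unknown direction, leave only
the two known ones (`FormParams.flatDir_unique`): a non-real normal must have `k = 2d` and real part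
`S`, and a real normal contradicts positivity or `S² < 1`. -/

namespace NilpotentNR

open Matrix ComplexConjugate
open scoped ComplexOrder

/-! ### Quadratic forms, the Hermitian pencil and unitary invariance. -/

section Quadratic

/-- The Hermitian matrix `k + z A + z̄ A*`. -/
def pencil {n : Type*} [DecidableEq n] (A : Matrix n n ℂ) (k : ℝ) (z : ℂ) : Matrix n n ℂ :=
  (k : ℂ) • 1 + z • A + conj z • Aᴴ

theorem pencil_isHermitian {n : Type*} [DecidableEq n] (A : Matrix n n ℂ) (k : ℝ) (z : ℂ) : (pencil A k z).IsHermitian := by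
  unfold pencil IsHermitian
  simp only [conjTranspose_add, conjTranspose_smul, conjTranspose_one, conjTranspose_conjTranspose,
    RCLike.star_def, Complex.conj_conj, Complex.conj_ofReal]
  abel

theorem pencil_smul {n : Type*} [DecidableEq n] (A : Matrix n n ℂ) (k : ℝ) (z c : ℂ) :
    pencil (c • A) k z = pencil A k (z * c) := by
  simp [pencil, smul_smul]

variable {n : Type*} [Fintype n]

/-- The quadratic form `v ↦ ⟨A v, v⟩` of a matrix. -/
def quad (A : Matrix n n ℂ) (v : n → ℂ) : ℂ := star v ⬝ᵥ A *ᵥ v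

theorem star_dotProduct_self_eq (v : n → ℂ) :
    star v ⬝ᵥ v = ((∑ i, ‖v i‖ ^ 2 : ℝ) : ℂ) := by
  simp only [dotProduct, Pi.star_apply, RCLike.star_def, Complex.ofReal_sum]
  refine Finset.sum_congr rfl fun i _ => ?_
  rw [mul_comm, Complex.mul_conj, Complex.normSq_eq_norm_sq]

theorem quad_conjTranspose (A : Matrix n n ℂ) (v : n → ℂ) : quad Aᴴ v = conj (quad A v) := by
  unfold quad
  rw [← RCLike.star_def, star_dotProduct, star_mulVec, dotProduct_mulVec,
    conjTranspose_conjTranspose]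

theorem quad_smul_vec (A : Matrix n n ℂ) (c : ℂ) (v : n → ℂ) :
    quad A (c • v) = (‖c‖ ^ 2 : ℝ) * quad A v := by
  have : conj c * c = ((‖c‖ ^ 2 : ℝ) : ℂ) := by
    rw [mul_comm, Complex.mul_conj, Complex.normSq_eq_norm_sq]
  simp only [quad, star_smul, smul_dotProduct, mulVec_smul, dotProduct_smul, smul_eq_mul,
    RCLike.star_def]
  rw [← this]; ring

theorem exists_unit_smul {v : n → ℂ} (hv : v ≠ 0) :
    ∃ r : ℝ, 0 < r ∧ star v ⬝ᵥ v = (r ^ 2 : ℝ) ∧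
      star ((r⁻¹ : ℂ) • v) ⬝ᵥ ((r⁻¹ : ℂ) • v) = 1 := by
  have hpos : 0 < ∑ i, ‖v i‖ ^ 2 := by
    obtain ⟨i, hi⟩ := Function.ne_iff.1 hv
    exact Finset.sum_pos' (fun _ _ => by positivity) ⟨i, Finset.mem_univ _, by
      have := norm_pos_iff.2 (show v i ≠ 0 from hi); positivity⟩
  refine ⟨√(∑ i, ‖v i‖ ^ 2), Real.sqrt_pos.2 hpos, ?_, ?_⟩
  · rw [Real.sq_sqrt hpos.le, star_dotProduct_self_eq]
  · simp only [star_smul, smul_dotProduct, dotProduct_smul, smul_eq_mul, RCLike.star_def,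
      map_inv₀, Complex.conj_ofReal]
    rw [star_dotProduct_self_eq, ← Complex.ofReal_inv, ← Complex.ofReal_mul, ← Complex.ofReal_mul,
      ← Complex.ofReal_one, Complex.ofReal_inj]
    have := Real.mul_self_sqrt hpos.le
    have h2 : √(∑ i, ‖v i‖ ^ 2) ≠ 0 := (Real.sqrt_pos.2 hpos).ne'
    field_simp
    linarith

theorem quad_unitary_conj (U A : Matrix n n ℂ) (v : n → ℂ) :
    quad (U * A * star U) v = quad A (star U *ᵥ v) := by
  unfold quad
  rw [star_mulVec, ← mulVec_mulVec, ← mulVec_mulVec, dotProduct_mulVec]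
  simp [star_eq_conjTranspose]

theorem quad_smul (A : Matrix n n ℂ) (c : ℂ) (v : n → ℂ) : quad (c • A) v = c * quad A v := by
  simp [quad, smul_mulVec]

variable [DecidableEq n]

theorem mem_numericalRange_iff {A : Matrix n n ℂ} {z : ℂ} :
    z ∈ numericalRange A ↔ ∃ v : n → ℂ, star v ⬝ᵥ v = 1 ∧ quad A v = z := by
  have key : ∀ v : EuclideanSpace ℂ n, ‖v‖ = 1 ↔ star v.ofLp ⬝ᵥ v.ofLp = 1 := by
    intro v
    rw [star_dotProduct_self_eq, ← EuclideanSpace.norm_sq_eq, ← Complex.ofReal_one,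
      Complex.ofReal_inj, pow_eq_one_iff_of_nonneg (norm_nonneg v) two_ne_zero]
  constructor
  · rintro ⟨v, hv, rfl⟩
    refine ⟨v.ofLp, (key v).1 hv, ?_⟩
    rw [EuclideanSpace.inner_eq_star_dotProduct, dotProduct_comm]
    rfl
  · rintro ⟨v, hv, rfl⟩
    refine ⟨WithLp.toLp 2 v, (key _).2 hv, ?_⟩
    rw [EuclideanSpace.inner_eq_star_dotProduct, dotProduct_comm]
    rfl

theorem quad_pencil (A : Matrix n n ℂ) (k : ℝ) (z : ℂ) (v : n → ℂ) :
    quad (pencil A k z) v = k * (star v ⬝ᵥ v) + ((2 * (z * quad A v).re : ℝ) : ℂ) := by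
  have h := quad_conjTranspose A v
  have h2 : ((2 * (z * quad A v).re : ℝ) : ℂ) = z * quad A v + conj (z * quad A v) := by
    rw [Complex.add_conj]
  rw [h2, map_mul, ← h]
  simp only [quad, pencil, add_mulVec, smul_mulVec, one_mulVec, dotProduct_add, dotProduct_smul,
    smul_eq_mul]
  ring

/-- The line `Re (z w) = -k / 2` supports the numerical range of `A` and contains two of its
points. -/
def FlatDir (A : Matrix n n ℂ) (k : ℝ) (z : ℂ) : Prop :=
  (pencil A k z).PosSemidef ∧ ∃ v w : n → ℂ, star v ⬝ᵥ v = 1 ∧ star w ⬝ᵥ w = 1 ∧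
    pencil A k z *ᵥ v = 0 ∧ pencil A k z *ᵥ w = 0 ∧ quad A v ≠ quad A w

/-- At a unit vector `v` the form of the pencil is `k + 2 Re (z⟨Av,v⟩)`; scaling covers the other
vectors. -/
theorem pencil_posSemidef_iff {A : Matrix n n ℂ} {k : ℝ} {z : ℂ} :
    (pencil A k z).PosSemidef ↔ ∀ w ∈ numericalRange A, -(k / 2) ≤ (z * w).re := by
  constructor
  · rintro h w hw
    obtain ⟨v, hv, rfl⟩ := mem_numericalRange_iff.1 hw
    have := h.dotProduct_mulVec_nonneg v
    change 0 ≤ quad _ v at this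
    rw [quad_pencil, hv, mul_one, ← Complex.ofReal_add, Complex.zero_le_real] at this
    linarith
  · intro h
    refine PosSemidef.of_dotProduct_mulVec_nonneg (pencil_isHermitian A k z) fun v => ?_
    change 0 ≤ quad _ v
    by_cases hv : v = 0
    · simp [hv, quad]
    obtain ⟨r, hr, hr2, hu⟩ := exists_unit_smul hv
    have h1 := h _ (mem_numericalRange_iff.2 ⟨_, hu, rfl⟩)
    have h2 : v = (r : ℂ) • ((r⁻¹ : ℂ) • v) := by
      rw [smul_smul, mul_inv_cancel₀ (by exact_mod_cast hr.ne'), one_smul]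
    have h3 : quad A v = (r ^ 2 : ℝ) * quad A ((r⁻¹ : ℂ) • v) := by
      conv_lhs => rw [h2]
      rw [quad_smul_vec]; simp
    rw [quad_pencil, hr2, h3, mul_left_comm, Complex.re_ofReal_mul, ← Complex.ofReal_mul,
      ← Complex.ofReal_add, Complex.zero_le_real]
    nlinarith [sq_nonneg r, mul_nonneg (sq_nonneg r) (sub_nonneg.2 h1)]

theorem pencil_mulVec_eq_zero_iff {A : Matrix n n ℂ} {k : ℝ} {z : ℂ}
    (h : (pencil A k z).PosSemidef) {v : n → ℂ} (hv : star v ⬝ᵥ v = 1) :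
    pencil A k z *ᵥ v = 0 ↔ (z * quad A v).re = -(k / 2) := by
  rw [← h.dotProduct_mulVec_zero_iff]
  change quad _ v = 0 ↔ _
  rw [quad_pencil, hv, mul_one, ← Complex.ofReal_add, Complex.ofReal_eq_zero]
  constructor <;> intro h <;> linarith

theorem star_mulVec_unitary {U : Matrix n n ℂ} (hU : U ∈ unitaryGroup n ℂ) (v w : n → ℂ) :
    star (U *ᵥ v) ⬝ᵥ (U *ᵥ w) = star v ⬝ᵥ w := by
  rw [star_mulVec, dotProduct_mulVec, vecMul_vecMul, ← dotProduct_mulVec]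
  have : Uᴴ * U = 1 := mem_unitaryGroup_iff'.1 hU
  rw [this, one_mulVec]

theorem pencil_unitary_conj {U : Matrix n n ℂ} (hU : U ∈ unitaryGroup n ℂ) (A : Matrix n n ℂ)
    (k : ℝ) (z : ℂ) : pencil (U * A * star U) k z = U * pencil A k z * star U := by
  have h1 : U * star U = 1 := mem_unitaryGroup_iff.1 hU
  unfold pencil
  simp only [star_eq_conjTranspose] at h1 ⊢
  simp only [conjTranspose_mul, conjTranspose_conjTranspose, mul_add, add_mul, Matrix.mul_smul,
    Matrix.smul_mul, Matrix.mul_one, h1, Matrix.mul_assoc]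

theorem numericalRange_unitary_smul {U : Matrix n n ℂ} (hU : U ∈ unitaryGroup n ℂ) (c : ℂ)
    (A : Matrix n n ℂ) {w : ℂ} :
    w ∈ numericalRange (U * (c • A) * star U) ↔ ∃ w' ∈ numericalRange A, w = c * w' := by
  simp only [mem_numericalRange_iff]
  constructor
  · rintro ⟨v, hv, rfl⟩
    refine ⟨_, ⟨star U *ᵥ v, ?_, rfl⟩, by rw [quad_unitary_conj, quad_smul]⟩
    rw [star_mulVec_unitary (Unitary.star_mem hU), hv]
  · rintro ⟨_, ⟨v, hv, rfl⟩, rfl⟩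
    refine ⟨U *ᵥ v, by rw [star_mulVec_unitary hU, hv], ?_⟩
    rw [quad_unitary_conj, quad_smul, mulVec_mulVec, mem_unitaryGroup_iff'.1 hU, one_mulVec]

end Quadratic

/-! ### Compactness and convexity of the numerical range. -/

section ToeplitzHausdorff

variable {n : Type*} [Fintype n] [DecidableEq n]

theorem isCompact_numericalRange (A : Matrix n n ℂ) : IsCompact (numericalRange A) := by
  have : numericalRange A = (fun v : EuclideanSpace ℂ n =>
      inner ℂ v (Matrix.toEuclideanLin A v)) '' Metric.sphere 0 1 := by
    ext z; simp [numericalRange]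
  rw [this]
  refine (isCompact_sphere _ _).image ?_
  exact continuous_id.inner (LinearMap.continuous_of_finiteDimensional _)

/-- Since `Im (c̄β) = -Im (cβ̄)`, only `c(α - β̄)` has to be made real. -/
theorem exists_phase_im_eq_zero (α β : ℂ) : ∃ c : ℂ, ‖c‖ = 1 ∧ (c * α + conj c * β).im = 0 := by
  set γ := α - conj β with hγ
  by_cases h : γ = 0
  · refine ⟨1, by simp, ?_⟩
    have : α = conj β := sub_eq_zero.1 h
    simp [this]
  · refine ⟨conj γ / ‖γ‖, by simp [h], ?_⟩
    have h1 : conj γ * γ = ((‖γ‖ ^ 2 : ℝ) : ℂ) := by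
      rw [mul_comm, Complex.mul_conj, Complex.normSq_eq_norm_sq]
    set c := conj γ / (‖γ‖ : ℂ) with hc
    have h2 : (c * γ).im = 0 := by
      rw [hc, div_mul_eq_mul_div, h1, ← Complex.ofReal_div, Complex.ofReal_im]
    rw [hγ] at h2
    simp at h2 ⊢
    linarith

/-- The Toeplitz–Hausdorff theorem. -/
theorem convex_numericalRange (A : Matrix n n ℂ) : Convex ℝ (numericalRange A) := by
  rw [convex_iff_segment_subset]
  intro p hp q hq
  by_cases hpq : p = q
  · subst hpq; simpa using hp
  obtain ⟨v, hv, rfl⟩ := mem_numericalRange_iff.1 hp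
  obtain ⟨w, hw, rfl⟩ := mem_numericalRange_iff.1 hq
  set p := quad A v with hpdef
  set q := quad A w with hqdef
  have hd : q - p ≠ 0 := sub_ne_zero.2 (Ne.symm hpq)
  -- After the affine normalization sending `p` to 0 and `q` to 1, the phase `c` makes the cross
  -- term of `⟨Au,u⟩` along the path `u` real, so the normalized values stay on the real axis.
  obtain ⟨c, hc, him⟩ := exists_phase_im_eq_zero
    ((star v ⬝ᵥ A *ᵥ w - p * (star v ⬝ᵥ w)) / (q - p))
    ((star w ⬝ᵥ A *ᵥ v - p * (star w ⬝ᵥ v)) / (q - p))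
  have hcc : conj c * c = 1 := by
    rw [mul_comm, Complex.mul_conj, Complex.normSq_eq_norm_sq, hc]; simp
  set m : ℝ := (c * ((star v ⬝ᵥ A *ᵥ w - p * (star v ⬝ᵥ w)) / (q - p)) +
    conj c * ((star w ⬝ᵥ A *ᵥ v - p * (star w ⬝ᵥ v)) / (q - p))).re with hm
  have hmc : c * ((star v ⬝ᵥ A *ᵥ w - p * (star v ⬝ᵥ w)) / (q - p)) +
    conj c * ((star w ⬝ᵥ A *ᵥ v - p * (star w ⬝ᵥ v)) / (q - p)) = (m : ℂ) := by
    exact Complex.ext rfl (by rw [him, Complex.ofReal_im])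
  let u : ℝ → n → ℂ := fun s => ((1 - s : ℝ) : ℂ) • v + (s * c : ℂ) • w
  have hquad : ∀ s : ℝ, quad A (u s) = p * (star (u s) ⬝ᵥ u s) +
      (q - p) * ((s * (1 - s) * m + s ^ 2 : ℝ) : ℂ) := by
    intro s
    have e1 : (q - p) * (m : ℂ) = c * (star v ⬝ᵥ A *ᵥ w - p * (star v ⬝ᵥ w)) +
      conj c * (star w ⬝ᵥ A *ᵥ v - p * (star w ⬝ᵥ v)) := by
      rw [← hmc]; field_simp
    have hp' : star v ⬝ᵥ A *ᵥ v = p := rfl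
    have hq' : star w ⬝ᵥ A *ᵥ w = q := rfl
    simp only [u, quad, star_add, star_smul, mulVec_add, mulVec_smul, add_dotProduct,
      dotProduct_add, smul_dotProduct, dotProduct_smul, smul_eq_mul, RCLike.star_def, map_mul,
      Complex.conj_ofReal, hp', hq', hv, hw]
    push_cast
    linear_combination (-(s * (1 - s)) : ℂ) * e1 + (s ^ 2 * q - s ^ 2 * p : ℂ) * hcc
  -- If `u s = 0`, then `v` and `w` differ by a factor of modulus one and give the same value,
  -- against `p ≠ q`.
  have hne : ∀ s : ℝ, u s ≠ 0 := by
    intro s hs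
    have h0 := hquad s
    have : quad A (u s) = 0 := by rw [hs]; simp [quad]
    rw [this, hs] at h0
    simp only [dotProduct_zero, mul_zero, zero_add] at h0
    have h1 : s * (1 - s) * m + s ^ 2 = 0 := by
      have := (mul_eq_zero.1 h0.symm).resolve_left hd
      exact_mod_cast this
    have hw' : w ≠ 0 := by rintro rfl; simp at hw
    by_cases hs1 : s = 0
    · subst hs1
      have : v = 0 := by simpa [u] using hs
      rw [this] at hv; simp at hv
    have h2 : ((1 - s : ℝ) : ℂ) • v = (-(s * c : ℂ)) • w := by
      have : ((1 - s : ℝ) : ℂ) • v + (s * c : ℂ) • w = 0 := hs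
      rw [neg_smul]; exact eq_neg_of_add_eq_zero_left this
    have h3 := congrArg (quad A) h2
    have h4 := congrArg (fun x => star x ⬝ᵥ x) h2
    rw [quad_smul_vec, quad_smul_vec] at h3
    simp only [star_smul, smul_dotProduct, dotProduct_smul, smul_eq_mul, hv, hw, RCLike.star_def,
      mul_one, map_neg, map_mul, Complex.conj_ofReal] at h4
    have h5 : (((1 - s) ^ 2 : ℝ) : ℂ) = ((s ^ 2 : ℝ) : ℂ) := by
      push_cast
      push_cast at h4
      linear_combination h4 + (s ^ 2 : ℂ) * hcc
    have h6 : ‖((1 - s : ℝ) : ℂ)‖ ^ 2 = (1 - s) ^ 2 := by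
      rw [Complex.norm_real, Real.norm_eq_abs, sq_abs]
    have h7 : ‖(-(s * c : ℂ))‖ ^ 2 = s ^ 2 := by
      rw [norm_neg, norm_mul, hc, mul_one, Complex.norm_real, Real.norm_eq_abs, sq_abs]
    rw [h6, h7, h5] at h3
    have h8 : ((s ^ 2 : ℝ) : ℂ) ≠ 0 := by
      rw [Ne, Complex.ofReal_eq_zero]; positivity
    exact hpq (mul_left_cancel₀ h8 h3)
  let N : ℝ → ℝ := fun s => ∑ i, ‖u s i‖ ^ 2
  have hN : ∀ s, star (u s) ⬝ᵥ u s = (N s : ℂ) := fun s => star_dotProduct_self_eq _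
  have hNpos : ∀ s, 0 < N s := by
    intro s
    obtain ⟨i, hi⟩ := Function.ne_iff.1 (hne s)
    exact Finset.sum_pos' (fun _ _ => by positivity) ⟨i, Finset.mem_univ _, by
      have := norm_pos_iff.2 (show u s i ≠ 0 from hi); positivity⟩
  have hNc : Continuous N := by
    simp only [N, u, Pi.add_apply, Pi.smul_apply, smul_eq_mul]
    fun_prop
  let g : ℝ → ℝ := fun s => (s * (1 - s) * m + s ^ 2) / N s
  have hg : ContinuousOn g (Set.Icc 0 1) := by
    refine Continuous.continuousOn (Continuous.div (by fun_prop) hNc fun s => (hNpos s).ne')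
  have hN1 : N 1 = 1 := by
    have h1 := hN 1
    simp only [u, star_smul, smul_dotProduct, dotProduct_smul, smul_eq_mul, sub_self,
      Complex.ofReal_zero, zero_smul, zero_add, hw, RCLike.star_def, mul_one, Complex.ofReal_one,
      one_mul] at h1
    rw [mul_comm, hcc] at h1
    exact_mod_cast h1.symm
  intro z hz
  rw [segment_eq_image'] at hz
  obtain ⟨t, ht, rfl⟩ := hz
  -- The continuous function `g` runs from 0 to 1, so it attains the prescribed ratio `t`.
  obtain ⟨s, -, hs⟩ := intermediate_value_Icc zero_le_one hg
    (show t ∈ Set.Icc (g 0) (g 1) by simpa [g, hN1] using ht)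
  obtain ⟨r, hr, hr2, hu⟩ := exists_unit_smul (hne s)
  refine mem_numericalRange_iff.2 ⟨_, hu, ?_⟩
  have hrN : r ^ 2 = N s := by
    rw [hN] at hr2; exact_mod_cast hr2.symm
  have hs' : s * (1 - s) * m + s ^ 2 = t * r ^ 2 := by
    rw [← hs, hrN]; simp only [g]
    rw [div_mul_cancel₀ _ (hNpos s).ne']
  rw [quad_smul_vec, hquad, hr2, hs', norm_inv, Complex.norm_real, Real.norm_eq_abs,
    abs_of_pos hr]
  have : (r : ℂ) ≠ 0 := by exact_mod_cast hr.ne'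
  simp only [Complex.real_smul]
  push_cast
  field_simp

end ToeplitzHausdorff

/-! ### Support lines, faces and flat portions of plane convex sets. -/

section Support

theorem conj_mul_self_of_norm_eq_one {z : ℂ} (hz : ‖z‖ = 1) : conj z * z = 1 := by
  rw [mul_comm, Complex.mul_conj, Complex.normSq_eq_norm_sq, hz]; simp

theorem exists_unit_of_linearMap {f : ℂ →ₗ[ℝ] ℝ} (hf : f ≠ 0) :
    ∃ z : ℂ, ‖z‖ = 1 ∧ ∃ r : ℝ, 0 < r ∧ ∀ w, f w = r * (z * w).re := by
  have hfw : ∀ w, f w = ((⟨f 1, -f Complex.I⟩ : ℂ) * w).re := by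
    intro w
    have : w = w.re • (1 : ℂ) + w.im • Complex.I := by simp
    conv_lhs => rw [this]
    simp only [map_add, map_smul, smul_eq_mul, Complex.mul_re]
    ring
  set c : ℂ := ⟨f 1, -f Complex.I⟩ with hc
  have hc0 : c ≠ 0 := by
    intro h
    apply hf
    ext
    rw [hfw, h]
    simp
  refine ⟨c / ‖c‖, by simp [hc0], ‖c‖, norm_pos_iff.2 hc0, fun w => ?_⟩
  have h1 : (‖c‖ : ℂ) ≠ 0 := by exact_mod_cast (norm_pos_iff.2 hc0).ne'
  rw [hfw, ← Complex.re_ofReal_mul, ← mul_assoc, mul_div_cancel₀ _ h1]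

/-- Real functionals on `ℂ` are multiples of `w ↦ Re (z w)`, so a Hahn–Banach functional at `m`
suffices. -/
theorem exists_support {K : Set ℂ} (hc : Convex ℝ K) (hcl : IsClosed K) {m : ℂ}
    (hm : m ∈ frontier K) : ∃ z : ℂ, ‖z‖ = 1 ∧ ∀ w ∈ K, (z * m).re ≤ (z * w).re := by
  have hmK : m ∈ K := hcl.frontier_subset hm
  suffices h : ∃ f : ℂ →ₗ[ℝ] ℝ, f ≠ 0 ∧ ∀ w ∈ K, f m ≤ f w by
    obtain ⟨f, hf, hfw⟩ := h
    obtain ⟨z, hz, r, hr, hzw⟩ := exists_unit_of_linearMap hf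
    refine ⟨z, hz, fun w hw => ?_⟩
    have := hfw w hw
    rw [hzw, hzw] at this
    exact le_of_mul_le_mul_left this hr
  by_cases hi : (interior K).Nonempty
  · obtain ⟨f, hf⟩ := geometric_hahn_banach_open_point hc.interior isOpen_interior hm.2
    refine ⟨-(f : ℂ →ₗ[ℝ] ℝ), ?_, fun w hw => ?_⟩
    · intro h0
      obtain ⟨a, ha⟩ := hi
      have h1 := hf a ha
      have h2 : ∀ x, f x = 0 := fun x => by
        have := LinearMap.congr_fun h0 x
        simpa using this
      rw [h2, h2] at h1
      exact lt_irrefl _ h1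
    · have hw' : w ∈ closure (interior K) := by
        rw [hc.closure_interior_eq_closure_of_nonempty_interior hi]
        exact subset_closure hw
      have : closure (interior K) ⊆ {x | f x ≤ f m} :=
        closure_minimal (fun a ha => (hf a ha).le) (isClosed_le f.continuous continuous_const)
      simpa using this hw'
  -- With empty interior, `K` lies in a proper affine subspace, on which some nonzero functional is
  -- constant.
  · rw [hc.interior_nonempty_iff_affineSpan_eq_top] at hi
    have hd : (affineSpan ℝ K).direction < ⊤ := by
      rw [lt_top_iff_ne_top]
      intro h
      exact hi ((AffineSubspace.direction_eq_top_iff_of_nonempty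
        ⟨m, subset_affineSpan ℝ K hmK⟩).1 h)
    obtain ⟨f, hf0, hf⟩ := Submodule.exists_le_ker_of_lt_top _ hd
    refine ⟨f, hf0, fun w hw => ?_⟩
    have h1 : w -ᵥ m ∈ (affineSpan ℝ K).direction :=
      AffineSubspace.vsub_mem_direction (subset_affineSpan ℝ K hw) (subset_affineSpan ℝ K hmK)
    have h2 := hf h1
    rw [LinearMap.mem_ker, vsub_eq_sub, map_sub] at h2
    linarith

theorem mem_frontier_of_support {K : Set ℂ} {z w : ℂ} {l : ℝ} (hz : ‖z‖ = 1)
    (hK : ∀ w ∈ K, l ≤ (z * w).re) (hw : w ∈ K) (hl : (z * w).re = l) : w ∈ frontier K := by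
  refine ⟨subset_closure hw, fun hi => ?_⟩
  obtain ⟨ε, hε, hb⟩ := Metric.mem_nhds_iff.1 (mem_interior_iff_mem_nhds.1 hi)
  have h1 : w - (ε / 2 : ℝ) * conj z ∈ K := by
    apply hb
    rw [Metric.mem_ball, dist_eq_norm, sub_sub_cancel_left, norm_neg, norm_mul, RCLike.norm_conj,
      hz, mul_one, Complex.norm_real, Real.norm_eq_abs, abs_of_pos (half_pos hε)]
    exact half_lt_self hε
  have h2 := hK _ h1
  have h3 : z * (w - (ε / 2 : ℝ) * conj z) = z * w - (ε / 2 : ℝ) := by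
    linear_combination (-(ε / 2 : ℝ) : ℂ) * conj_mul_self_of_norm_eq_one hz
  rw [h3, Complex.sub_re, Complex.ofReal_re, hl] at h2
  linarith

/-- The point with `z w = l + i h` on the line `Re (z w) = l`. -/
def linePoint (z : ℂ) (l h : ℝ) : ℂ := conj z * ⟨l, h⟩

theorem mul_linePoint {z : ℂ} (hz : ‖z‖ = 1) (l h : ℝ) : z * linePoint z l h = ⟨l, h⟩ := by
  unfold linePoint
  linear_combination (⟨l, h⟩ : ℂ) * conj_mul_self_of_norm_eq_one hz

theorem eq_linePoint_iff {z : ℂ} (hz : ‖z‖ = 1) {w : ℂ} {l h : ℝ} :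
    w = linePoint z l h ↔ (z * w).re = l ∧ (z * w).im = h := by
  constructor
  · rintro rfl
    rw [mul_linePoint hz]; exact ⟨rfl, rfl⟩
  · rintro ⟨rfl, rfl⟩
    unfold linePoint
    rw [Complex.eta]
    linear_combination -w * conj_mul_self_of_norm_eq_one hz

theorem dist_of_re_eq {z : ℂ} (hz : ‖z‖ = 1) {p q : ℂ} (h : (z * p).re = (z * q).re) :
    dist p q = |(z * p).im - (z * q).im| := by
  have h1 : ‖z * (p - q)‖ = ‖p - q‖ := by rw [norm_mul, hz, one_mul]
  have h2 : z * (p - q) = (((z * p).im - (z * q).im : ℝ) : ℂ) * Complex.I := by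
    apply Complex.ext
    · rw [mul_sub, Complex.sub_re, h]; simp
    · rw [mul_sub, Complex.sub_im]; simp
  rw [dist_eq_norm, ← h1, h2, norm_mul, Complex.norm_I, mul_one, Complex.norm_real,
    Real.norm_eq_abs]

theorem mem_segment_linePoint_iff {z : ℂ} (hz : ‖z‖ = 1) {w : ℂ} {l a b : ℝ} :
    w ∈ segment ℝ (linePoint z l a) (linePoint z l b) ↔
      (z * w).re = l ∧ (z * w).im ∈ segment ℝ a b := by
  constructor
  · rintro ⟨s, t, hs, ht, hst, rfl⟩
    have : z * (s • linePoint z l a + t • linePoint z l b) =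
        s • (z * linePoint z l a) + t • (z * linePoint z l b) := by
      simp only [Complex.real_smul]; ring
    rw [this, mul_linePoint hz, mul_linePoint hz]
    refine ⟨?_, s, t, hs, ht, hst, ?_⟩
    · simp only [Complex.add_re, Complex.smul_re, smul_eq_mul]
      rw [← add_mul, hst, one_mul]
    · simp
  · rintro ⟨h1, s, t, hs, ht, hst, h2⟩
    refine ⟨s, t, hs, ht, hst, ?_⟩
    rw [(eq_linePoint_iff hz).2 ⟨h1, h2.symm⟩]
    unfold linePoint
    have : ((⟨l, s • a + t • b⟩ : ℂ)) = s * (⟨l, a⟩ : ℂ) + t * (⟨l, b⟩ : ℂ) := by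
      apply Complex.ext
      · simp only [Complex.add_re, Complex.re_ofReal_mul]
        rw [← add_mul, hst, one_mul]
      · simp only [Complex.add_im, Complex.im_ofReal_mul, smul_eq_mul]
    rw [this]
    simp only [Complex.real_smul]
    ring

theorem mem_segment_of_re_eq {z : ℂ} (hz : ‖z‖ = 1) {w p q : ℂ} {l : ℝ} (hp : (z * p).re = l)
    (hq : (z * q).re = l) :
    w ∈ segment ℝ p q ↔ (z * w).re = l ∧ (z * w).im ∈ segment ℝ (z * p).im (z * q).im := by
  rw [← mem_segment_linePoint_iff hz, ← (eq_linePoint_iff hz).2 ⟨hp, rfl⟩,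
    ← (eq_linePoint_iff hz).2 ⟨hq, rfl⟩]

/-- The line `Re (z w) = l` supports `K` and meets it in the segment `[p, q]`. -/
def IsFace (K : Set ℂ) (z : ℂ) (l : ℝ) (p q : ℂ) : Prop :=
  (∀ w ∈ K, l ≤ (z * w).re) ∧ ∀ w, w ∈ segment ℝ p q ↔ w ∈ K ∧ (z * w).re = l

/-- A support line at the midpoint contains both endpoints, because neither lies below it and their
mean is on it. A further point of `K` on this line would lengthen the segment inside the boundary,
against maximality. -/
theorem IsFlatPortion.exists_isFace {K : Set ℂ} (hc : Convex ℝ K) (hcl : IsClosed K) {p q : ℂ}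
    (h : IsFlatPortion K p q) : ∃ z l, ‖z‖ = 1 ∧ IsFace K z l p q := by
  obtain ⟨hpq, hsub, hmax⟩ := h
  have hseg : segment ℝ p q ⊆ K := hsub.trans hcl.frontier_subset
  have hmid : midpoint ℝ p q ∈ segment ℝ p q := midpoint_mem_segment p q
  obtain ⟨z, hz, hzK⟩ := exists_support hc hcl (hsub hmid)
  set l := (z * midpoint ℝ p q).re with hl
  have hl2 : 2 * l = (z * p).re + (z * q).re := by
    rw [hl, midpoint_eq_smul_add]
    simp
    ring
  have hpK := hseg (left_mem_segment ℝ p q)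
  have hqK := hseg (right_mem_segment ℝ p q)
  have hp : (z * p).re = l := by linarith [hzK p hpK, hzK q hqK]
  have hq : (z * q).re = l := by linarith [hzK p hpK, hzK q hqK]
  refine ⟨z, l, hz, hzK, fun w => ⟨fun hw => ⟨hseg hw, ((mem_segment_of_re_eq hz hp hq).1 hw).1⟩,
    ?_⟩⟩
  rintro ⟨hwK, hw⟩
  have key : ∀ p' ∈ K, ∀ q' ∈ K, (z * p').re = l → (z * q').re = l →
      (z * p).im ∈ segment ℝ (z * p').im (z * q').im →
      (z * q).im ∈ segment ℝ (z * p').im (z * q').im →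
      (z * w).im ∈ segment ℝ (z * p').im (z * q').im → w ∈ segment ℝ p q := by
    intro p' hp' q' hq' h1 h2 h3 h4 h5
    rw [← hmax p' q' ?_ ?_]
    · exact (mem_segment_of_re_eq hz h1 h2).2 ⟨hw, h5⟩
    · refine (convex_segment p' q').segment_subset ?_ ?_
      · exact (mem_segment_of_re_eq hz h1 h2).2 ⟨hp, h3⟩
      · exact (mem_segment_of_re_eq hz h1 h2).2 ⟨hq, h4⟩
    · intro x hx
      exact mem_frontier_of_support hz hzK (hc.segment_subset hp' hq' hx)
        ((mem_segment_of_re_eq hz h1 h2).1 hx).1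
  simp only [segment_eq_uIcc, Set.mem_uIcc] at key
  -- On the line, the longest of the segments spanned by two of `p, q, w` contains all three points;
  -- the three instances cover every order.
  have k1 := key p hpK q hqK hp hq
  have k2 := key p hpK w hwK hp hw
  have k3 := key q hqK w hwK hq hw
  grind

/-- The contact set is compact and convex on a line, so it is the segment between its extreme
points. -/
theorem exists_isFlatPortion {K : Set ℂ} (hc : Convex ℝ K) (hK : IsCompact K) {z : ℂ} {l : ℝ}
    (hz : ‖z‖ = 1) (hs : ∀ w ∈ K, l ≤ (z * w).re) {a b : ℂ} (ha : a ∈ K) (hb : b ∈ K)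
    (hab : a ≠ b) (hal : (z * a).re = l) (hbl : (z * b).re = l) :
    ∃ p q, IsFlatPortion K p q ∧ IsFace K z l p q := by
  set F : Set ℂ := K ∩ {w | (z * w).re = l} with hF
  have hFc : IsCompact F := hK.inter_right
    (isClosed_eq (by fun_prop) continuous_const)
  have hcont : Continuous fun w : ℂ => (z * w).im := by fun_prop
  obtain ⟨p, hp, hpmin⟩ := hFc.exists_isMinOn ⟨a, ha, hal⟩ hcont.continuousOn
  obtain ⟨q, hq, hqmax⟩ := hFc.exists_isMaxOn ⟨a, ha, hal⟩ hcont.continuousOn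
  have hmin : ∀ w ∈ F, (z * p).im ≤ (z * w).im := fun w hw => hpmin hw
  have hmax : ∀ w ∈ F, (z * w).im ≤ (z * q).im := fun w hw => hqmax hw
  have hpq : p ≠ q := by
    rintro rfl
    apply hab
    have h1 : (z * a).im = (z * b).im := by
      linarith [hmin a ⟨ha, hal⟩, hmax a ⟨ha, hal⟩, hmin b ⟨hb, hbl⟩, hmax b ⟨hb, hbl⟩]
    rw [(eq_linePoint_iff hz).2 ⟨hal, h1⟩, ← (eq_linePoint_iff hz).2 ⟨hbl, rfl⟩]
  have hface : IsFace K z l p q := by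
    refine ⟨hs, fun w => ?_⟩
    rw [mem_segment_of_re_eq hz hp.2 hq.2]
    constructor
    · rintro ⟨h1, h2⟩
      exact ⟨hc.segment_subset hp.1 hq.1 ((mem_segment_of_re_eq hz hp.2 hq.2).2 ⟨h1, h2⟩), h1⟩
    · rintro ⟨h1, h2⟩
      refine ⟨h2, ?_⟩
      rw [segment_eq_uIcc, Set.mem_uIcc]
      exact Or.inl ⟨hmin w ⟨h1, h2⟩, hmax w ⟨h1, h2⟩⟩
  refine ⟨p, q, ⟨hpq, fun w hw => ?_, fun p' q' h1 h2 => ?_⟩, hface⟩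
  · exact mem_frontier_of_support hz hs ((hface.2 w).1 hw).1 ((hface.2 w).1 hw).2
  · refine Set.Subset.antisymm (fun w hw => ?_) h1
    have hsK : segment ℝ p' q' ⊆ K := h2.trans hK.isClosed.frontier_subset
    -- If `p'` were strictly above the line, `[p', q']` could meet it only at `q'`, yet it contains
    -- both `p` and `q`.
    have key : ∀ p' q' : ℂ, segment ℝ p q ⊆ segment ℝ p' q' → segment ℝ p' q' ⊆ K →
        (z * p').re = l := by
      intro p' q' h1 h2
      by_contra hne
      have hlt : l < (z * p').re := lt_of_le_of_ne (hs _ (h2 (left_mem_segment ℝ _ _))) (Ne.symm hne)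
      have hq'l : l ≤ (z * q').re := hs _ (h2 (right_mem_segment ℝ _ _))
      have aux : ∀ x ∈ segment ℝ p' q', (z * x).re = l → x = q' := by
        rintro x ⟨s, t, hs, ht, hst, rfl⟩ hx
        have h3 : (z * (s • p' + t • q')).re = s * (z * p').re + t * (z * q').re := by
          rw [← Complex.re_ofReal_mul, ← Complex.re_ofReal_mul, ← Complex.add_re]
          simp only [Complex.real_smul]
          ring_nf
        rw [h3] at hx
        have hs0 : s = 0 := by
          by_contra hs0
          have hspos : 0 < s := lt_of_le_of_ne hs (Ne.symm hs0)
          have ht1 : t = 1 - s := by linarith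
          subst ht1
          nlinarith [mul_pos hspos (sub_pos.2 hlt), mul_nonneg ht (sub_nonneg.2 hq'l)]
        have ht1 : t = 1 := by linarith
        simp [hs0, ht1]
      exact hpq ((aux p (h1 (left_mem_segment ℝ _ _)) hp.2).trans
        (aux q (h1 (right_mem_segment ℝ _ _)) hq.2).symm)
    have e1 := key p' q' h1 hsK
    have e2 := key q' p' (by rwa [segment_symm ℝ q' p']) (by rwa [segment_symm ℝ q' p'])
    exact (hface.2 w).2 ⟨hsK hw, ((mem_segment_of_re_eq hz e1 e2).1 hw).1⟩

end Support

/-! ### Distances and angles between support lines. -/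

section Lines

theorem mem_line_iff {z : ℂ} (hz : ‖z‖ = 1) {l : ℝ} {p q : ℂ} (hpq : p ≠ q)
    (hp : (z * p).re = l) (hq : (z * q).re = l) {w : ℂ} :
    w ∈ line[ℝ, p, q] ↔ (z * w).re = l := by
  rw [mem_affineSpan_pair_iff_exists_lineMap_eq]
  have himne : (z * q).im - (z * p).im ≠ 0 := by
    intro h
    apply hpq
    rw [(eq_linePoint_iff hz).2 ⟨hp, rfl⟩, (eq_linePoint_iff hz).2 ⟨hq, rfl⟩, sub_eq_zero.1 h]
  have e : ∀ r : ℝ, z * AffineMap.lineMap p q r =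
      ⟨l, (z * p).im + r * ((z * q).im - (z * p).im)⟩ := by
    intro r
    rw [AffineMap.lineMap_apply, vsub_eq_sub, vadd_eq_add, Complex.real_smul]
    have : z * (r * (q - p) + p) = r * (z * q - z * p) + z * p := by ring
    rw [this]
    apply Complex.ext
    · rw [Complex.add_re, Complex.re_ofReal_mul, Complex.sub_re, hp, hq]; simp
    · rw [Complex.add_im, Complex.im_ofReal_mul, Complex.sub_im]; simp; ring
  constructor
  · rintro ⟨r, rfl⟩
    rw [e]
  · intro hw
    refine ⟨((z * w).im - (z * p).im) / ((z * q).im - (z * p).im), ?_⟩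
    refine Eq.trans ((eq_linePoint_iff hz).2 ⟨by rw [e], ?_⟩)
      ((eq_linePoint_iff hz).2 ⟨hw, rfl⟩).symm
    rw [e]
    simp only
    field_simp
    ring

theorem infDist_line {z : ℂ} (hz : ‖z‖ = 1) {l : ℝ} {p q : ℂ} (hpq : p ≠ q)
    (hp : (z * p).re = l) (hq : (z * q).re = l) :
    Metric.infDist 0 (line[ℝ, p, q] : Set ℂ) = |l| := by
  have hmem : ∀ w, w ∈ (line[ℝ, p, q] : Set ℂ) ↔ (z * w).re = l := fun w =>
    mem_line_iff hz hpq hp hq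
  have h0 : linePoint z l 0 ∈ (line[ℝ, p, q] : Set ℂ) := by
    rw [hmem, mul_linePoint hz]
  apply le_antisymm
  · refine (Metric.infDist_le_dist_of_mem h0).trans ?_
    rw [dist_zero_left, linePoint, norm_mul, RCLike.norm_conj, hz, one_mul]
    have : (⟨l, 0⟩ : ℂ) = (l : ℂ) := rfl
    rw [this, Complex.norm_real, Real.norm_eq_abs]
  · refine (Metric.le_infDist ⟨_, h0⟩).2 fun w hw => ?_
    rw [hmem] at hw
    rw [dist_zero_left, ← hw]
    refine (Complex.abs_re_le_norm _).trans ?_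
    rw [norm_mul, hz, one_mul]

theorem sub_eq_of_re_eq {z : ℂ} (hz : ‖z‖ = 1) {a s : ℂ} (h : (z * a).re = (z * s).re) :
    a - s = ((z * a).im - (z * s).im : ℝ) * Complex.I * conj z := by
  have h2 : z * (a - s) = (((z * a).im - (z * s).im : ℝ) : ℂ) * Complex.I := by
    apply Complex.ext
    · rw [mul_sub, Complex.sub_re, h]; simp
    · rw [mul_sub, Complex.sub_im]; simp
  rw [← h2]
  linear_combination (s - a) * conj_mul_self_of_norm_eq_one hz

/-- The angle between the rays from the common point `s` of two support lines through points
`a`, `b` of the supported set. -/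
theorem cos_angle_of_support {z₁ z₂ : ℂ} (h₁ : ‖z₁‖ = 1) (h₂ : ‖z₂‖ = 1) {l : ℝ} {s a b : ℂ}
    (hs₁ : (z₁ * s).re = l) (hs₂ : (z₂ * s).re = l) (ha₁ : (z₁ * a).re = l)
    (ha₂ : l ≤ (z₂ * a).re) (hb₁ : l ≤ (z₁ * b).re) (hb₂ : (z₂ * b).re = l) (has : a ≠ s)
    (hbs : b ≠ s) :
    ((z₁ * conj z₂).im ≠ 0 → Real.cos (EuclideanGeometry.angle a s b) = -(z₁ * conj z₂).re) ∧
    ((z₁ * conj z₂).im = 0 → Real.sin (EuclideanGeometry.angle a s b) = 0) := by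
  have ea := sub_eq_of_re_eq h₁ (ha₁.trans hs₁.symm)
  have eb := sub_eq_of_re_eq h₂ (hb₂.trans hs₂.symm)
  set μ : ℝ := (z₁ * a).im - (z₁ * s).im
  set ν : ℝ := (z₂ * b).im - (z₂ * s).im
  have hμ : μ ≠ 0 := by
    intro h
    rw [h] at ea
    exact has (sub_eq_zero.1 (by simpa using ea))
  have hν : ν ≠ 0 := by
    intro h
    rw [h] at eb
    exact hbs (sub_eq_zero.1 (by simpa using eb))
  have i1 : 0 ≤ (z₂ * (a - s)).re := by rw [mul_sub, Complex.sub_re]; linarith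
  have i2 : 0 ≤ (z₁ * (b - s)).re := by rw [mul_sub, Complex.sub_re]; linarith
  have hna : ‖a - s‖ = |μ| := by rw [ea]; simp [h₁]
  have hnb : ‖b - s‖ = |ν| := by rw [eb]; simp [h₂]
  have hcos : Real.cos (EuclideanGeometry.angle a s b) = μ * ν * (z₁ * conj z₂).re / (|μ| * |ν|) := by
    rw [EuclideanGeometry.angle, InnerProductGeometry.cos_angle, vsub_eq_sub, vsub_eq_sub, hna, hnb,
      Complex.inner, ea, eb]
    congr 1
    simp
    ring
  have hsq : (z₁ * conj z₂).re ^ 2 + (z₁ * conj z₂).im ^ 2 = 1 := by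
    have : ‖z₁ * conj z₂‖ = 1 := by simp [h₁, h₂]
    have h3 := Complex.sq_norm (z₁ * conj z₂)
    rw [this, Complex.normSq_apply] at h3
    linarith
  have habs : 0 < |μ| * |ν| := by positivity
  constructor
  · intro hD
    -- Each of `a`, `b` lies on the inner side of the other support line; this forces `μ` and `ν` to
    -- have opposite signs, which fixes the sign of the cosine.
    have j1 : 0 ≤ μ * (z₁ * conj z₂).im := by
      rw [ea] at i1
      simp at i1 ⊢
      linarith
    have j2 : 0 ≤ -(ν * (z₁ * conj z₂).im) := by
      rw [eb] at i2
      simp at i2 ⊢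
      linarith
    have hneg : μ * ν = -(|μ| * |ν|) := by
      rw [← abs_mul]
      have : μ * ν ≤ 0 := by
        have h4 : μ * ν * (z₁ * conj z₂).im ^ 2 ≤ 0 := by nlinarith [mul_nonneg j1 j2]
        by_contra hc
        have := mul_pos (not_le.1 hc) (pow_pos (abs_pos.2 hD) 2)
        rw [sq_abs] at this
        linarith
      rw [abs_of_nonpos this]; ring
    rw [hcos, hneg]
    field_simp
  · intro hD
    rw [hD] at hsq
    have hc : Real.cos (EuclideanGeometry.angle a s b) ^ 2 = 1 := by
      rw [hcos, div_pow, mul_pow, mul_pow |μ|, sq_abs, sq_abs]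
      rw [div_eq_one_iff_eq (by positivity)]
      nlinarith
    have := Real.sin_sq_add_cos_sq (EuclideanGeometry.angle a s b)
    nlinarith

theorem exists_ne_of_mem_segment {p q s : ℂ} (hpq : p ≠ q) : ∃ a ∈ segment ℝ p q, a ≠ s := by
  by_cases h : p = s
  · exact ⟨q, right_mem_segment ℝ p q, fun h' => hpq (h.trans h'.symm)⟩
  · exact ⟨p, left_mem_segment ℝ p q, h⟩

theorem IsFace.left_mem {K : Set ℂ} {z : ℂ} {l : ℝ} {p q : ℂ} (h : IsFace K z l p q) :
    p ∈ K ∧ (z * p).re = l := (h.2 p).1 (left_mem_segment ℝ p q)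

theorem IsFace.right_mem {K : Set ℂ} {z : ℂ} {l : ℝ} {p q : ℂ} (h : IsFace K z l p q) :
    q ∈ K ∧ (z * q).re = l := (h.2 q).1 (right_mem_segment ℝ p q)

/-- As `0 ∈ K`, both support levels are nonpositive, so distance `d` means level `-d`. Normals that
are parallel would make `sin θ = 0`, so the cosine formula applies. -/
theorem HasTwoFlatPortions.exists_isFace {K : Set ℂ} (hc : Convex ℝ K) (hK : IsClosed K)
    (h0 : (0 : ℂ) ∈ K) {d θ : ℝ} (hθ : 0 < θ ∧ θ < Real.pi) (h : HasTwoFlatPortions K d θ) :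
    ∃ z₁ z₂ p₁ q₁ p₂ q₂, ‖z₁‖ = 1 ∧ ‖z₂‖ = 1 ∧ p₁ ≠ q₁ ∧ p₂ ≠ q₂ ∧ IsFace K z₁ (-d) p₁ q₁ ∧
      IsFace K z₂ (-d) p₂ q₂ ∧ (z₁ * conj z₂).re = -Real.cos θ := by
  obtain ⟨p₁, q₁, p₂, q₂, f₁, f₂, -, d₁, d₂, s, s₁, s₂, hang⟩ := h
  have hl : ∀ {p q : ℂ}, p ≠ q → ∀ {z l}, ‖z‖ = 1 → IsFace K z l p q →
      Metric.infDist 0 (line[ℝ, p, q] : Set ℂ) = d → l = -d := by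
    intro p q hpq z l hz hf hd
    rw [infDist_line hz hpq hf.left_mem.2 hf.right_mem.2] at hd
    have := hf.1 0 h0
    simp only [mul_zero, Complex.zero_re] at this
    rw [abs_of_nonpos this] at hd
    linarith
  obtain ⟨z₁, l₁, hz₁, g₁⟩ := f₁.exists_isFace hc hK
  obtain ⟨z₂, l₂, hz₂, g₂⟩ := f₂.exists_isFace hc hK
  obtain rfl := hl f₁.1 hz₁ g₁ d₁
  obtain rfl := hl f₂.1 hz₂ g₂ d₂
  refine ⟨z₁, z₂, p₁, q₁, p₂, q₂, hz₁, hz₂, f₁.1, f₂.1, g₁, g₂, ?_⟩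
  rw [mem_line_iff hz₁ f₁.1 g₁.left_mem.2 g₁.right_mem.2] at s₁
  rw [mem_line_iff hz₂ f₂.1 g₂.left_mem.2 g₂.right_mem.2] at s₂
  obtain ⟨a, ha, has⟩ := exists_ne_of_mem_segment (s := s) f₁.1
  obtain ⟨b, hb, hbs⟩ := exists_ne_of_mem_segment (s := s) f₂.1
  have haF := (g₁.2 a).1 ha
  have hbF := (g₂.2 b).1 hb
  obtain ⟨c₁, c₂⟩ := cos_angle_of_support hz₁ hz₂ s₁ s₂ haF.2 (g₂.1 a haF.1) (g₁.1 b hbF.1) hbF.2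
    has hbs
  rw [hang a ha b hb has hbs] at c₁ c₂
  have hD : (z₁ * conj z₂).im ≠ 0 := fun h => (Real.sin_pos_of_pos_of_lt_pi hθ.1 hθ.2).ne' (c₂ h)
  linarith [c₁ hD]

theorem hasTwoFlatPortions_of_support {K : Set ℂ} (hc : Convex ℝ K) (hK : IsCompact K) {d θ : ℝ}
    (hd : 0 < d) (hθ : 0 < θ ∧ θ < Real.pi) {z₁ z₂ : ℂ} (hz₁ : ‖z₁‖ = 1) (hz₂ : ‖z₂‖ = 1)
    (hz : (z₁ * conj z₂).re = -Real.cos θ) (hs₁ : ∀ w ∈ K, -d ≤ (z₁ * w).re)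
    (hs₂ : ∀ w ∈ K, -d ≤ (z₂ * w).re)
    (hf₁ : ∃ a ∈ K, ∃ b ∈ K, a ≠ b ∧ (z₁ * a).re = -d ∧ (z₁ * b).re = -d)
    (hf₂ : ∃ a ∈ K, ∃ b ∈ K, a ≠ b ∧ (z₂ * a).re = -d ∧ (z₂ * b).re = -d) :
    HasTwoFlatPortions K d θ := by
  obtain ⟨a, ha, b, hb, hab, hal, hbl⟩ := hf₁
  obtain ⟨p₁, q₁, f₁, g₁⟩ := exists_isFlatPortion hc hK hz₁ hs₁ ha hb hab hal hbl
  obtain ⟨a', ha', b', hb', hab', hal', hbl'⟩ := hf₂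
  obtain ⟨p₂, q₂, f₂, g₂⟩ := exists_isFlatPortion hc hK hz₂ hs₂ ha' hb' hab' hal' hbl'
  have hsq : (z₁ * conj z₂).re ^ 2 + (z₁ * conj z₂).im ^ 2 = 1 := by
    have : ‖z₁ * conj z₂‖ = 1 := by simp [hz₁, hz₂]
    have h3 := Complex.sq_norm (z₁ * conj z₂)
    rw [this, Complex.normSq_apply] at h3
    linarith
  have hsin := Real.sin_pos_of_pos_of_lt_pi hθ.1 hθ.2
  have hsc := Real.sin_sq_add_cos_sq θ
  have hD : (z₁ * conj z₂).im ≠ 0 := by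
    intro h
    rw [h, hz] at hsq
    nlinarith
  have hcpos : 0 < 1 - Real.cos θ := by nlinarith [Real.cos_le_one θ]
  refine ⟨p₁, q₁, p₂, q₂, f₁, f₂, ?_, ?_, ?_, ?_⟩
  · intro hpar
    have h1 : q₁ -ᵥ p₁ ∈ (line[ℝ, p₂, q₂]).direction := by
      rw [← hpar.direction_eq]
      exact AffineSubspace.vsub_mem_direction (right_mem_affineSpan_pair ℝ _ _)
        (left_mem_affineSpan_pair ℝ _ _)
    rw [direction_affineSpan, mem_vectorSpan_pair_rev] at h1
    obtain ⟨r, hr⟩ := h1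
    simp only [vsub_eq_sub] at hr
    have e1 := sub_eq_of_re_eq hz₁ (g₁.right_mem.2.trans g₁.left_mem.2.symm)
    have e2 : (z₂ * (q₁ - p₁)).re = 0 := by
      rw [← hr, Complex.real_smul, mul_left_comm, Complex.re_ofReal_mul, mul_sub, Complex.sub_re,
        g₂.right_mem.2, g₂.left_mem.2]
      simp
    have hne : (z₁ * q₁).im - (z₁ * p₁).im ≠ 0 := by
      intro h
      rw [h] at e1
      exact f₁.1 (sub_eq_zero.1 (by simpa using e1)).symm
    rw [e1] at e2
    apply hD
    have : ((z₁ * q₁).im - (z₁ * p₁).im) * (z₁ * conj z₂).im = 0 := by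
      rw [← e2]
      generalize (z₁ * q₁).im - (z₁ * p₁).im = μ
      simp
      ring
    exact (mul_eq_zero.1 this).resolve_left hne
  · rw [infDist_line hz₁ f₁.1 g₁.left_mem.2 g₁.right_mem.2, abs_neg, abs_of_pos hd]
  · rw [infDist_line hz₂ f₂.1 g₂.left_mem.2 g₂.right_mem.2, abs_neg, abs_of_pos hd]
  -- The lines share the level `-d`, so their common point lies along `conj (z₁ + z₂)`; the scale
  -- uses `1 + Re (z₁z̄₂) = 1 - cos θ`.
  · set s : ℂ := ((-d / (1 - Real.cos θ) : ℝ) : ℂ) * conj (z₁ + z₂) with hs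
    have n1 := conj_mul_self_of_norm_eq_one hz₁
    have n2 := conj_mul_self_of_norm_eq_one hz₂
    have s₁ : (z₁ * s).re = -d := by
      rw [hs, mul_left_comm, Complex.re_ofReal_mul, map_add, mul_add, mul_comm z₁, n1,
        Complex.add_re, hz, Complex.one_re]
      field_simp
      ring
    have s₂ : (z₂ * s).re = -d := by
      have : (z₂ * conj z₁).re = -Real.cos θ := by rw [← hz]; simp; ring
      rw [hs, mul_left_comm, Complex.re_ofReal_mul, map_add, mul_add, mul_comm z₂ (conj z₂), n2,
        Complex.add_re, this, Complex.one_re]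
      field_simp
      ring
    refine ⟨s, (mem_line_iff hz₁ f₁.1 g₁.left_mem.2 g₁.right_mem.2).2 s₁,
      (mem_line_iff hz₂ f₂.1 g₂.left_mem.2 g₂.right_mem.2).2 s₂, fun a ha b hb has hbs => ?_⟩
    have haF := (g₁.2 a).1 ha
    have hbF := (g₂.2 b).1 hb
    have := (cos_angle_of_support hz₁ hz₂ s₁ s₂ haF.2 (g₂.1 a haF.1) (g₁.1 b hbF.1) hbF.2
      has hbs).1 hD
    rw [hz, neg_neg] at this
    exact Real.injOn_cos ⟨EuclideanGeometry.angle_nonneg _ _ _, EuclideanGeometry.angle_le_pi _ _ _⟩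
      ⟨hθ.1.le, hθ.2.le⟩ this

end Lines

/-! ### Schur form of a nilpotent matrix. -/

section Triangularization

open Module

/-- A nilpotent operator on a finite-dimensional complex inner product space is strictly upper
triangular in some orthonormal basis. -/
theorem exists_orthonormalBasis_strictUpper (n : ℕ) : ∀ (E : Type) [NormedAddCommGroup E]
    [InnerProductSpace ℂ E] [FiniteDimensional ℂ E] (_ : finrank ℂ E = n) (f : E →ₗ[ℂ] E)
    (_ : IsNilpotent f), ∃ b : Fin n → E, Orthonormal ℂ b ∧
      ∀ i j, j ≤ i → inner ℂ (b i) (f (b j)) = 0 := by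
  induction n with
  | zero =>
    intro E _ _ _ _ f _
    exact ⟨Fin.elim0, ⟨fun i => i.elim0, fun i => i.elim0⟩, fun i => i.elim0⟩
  | succ n ih =>
    intro E _ _ _ hE f hf
    have hnt : Nontrivial E := Module.nontrivial_of_finrank_pos (R := ℂ) (by omega)
    obtain ⟨m, hm⟩ := hf
    have hadj : IsNilpotent (LinearMap.adjoint f) := by
      refine ⟨m, ?_⟩
      have := congrArg star hm
      rwa [star_pow, star_zero] at this
    -- A kernel vector of the adjoint is orthogonal to the range of `f`. Its orthogonal complement
    -- is then invariant, so it can serve as the last basis vector and the induction runs on the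
    -- complement.
    have hker : ∃ v : E, v ≠ 0 ∧ LinearMap.adjoint f v = 0 := by
      by_contra! hcon
      have hinj : Function.Injective (LinearMap.adjoint f) := by
        rw [← LinearMap.ker_eq_bot, LinearMap.ker_eq_bot']
        intro v hv
        by_contra hv0
        exact hcon v hv0 hv
      obtain ⟨m', hm'⟩ := hadj
      obtain ⟨x, hx⟩ := exists_ne (0 : E)
      have : Function.Injective ((LinearMap.adjoint f) ^ m') := by
        rw [Module.End.coe_pow]; exact hinj.iterate m'
      apply hx
      apply this
      rw [hm']; simp
    obtain ⟨v₀, hv₀, hfv₀⟩ := hker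
    set v : E := ((‖v₀‖⁻¹ : ℝ) : ℂ) • v₀ with hv
    have hvn : ‖v‖ = 1 := by
      rw [hv, norm_smul]
      simp [hv₀]
    have hfv : LinearMap.adjoint f v = 0 := by rw [hv, map_smul, hfv₀, smul_zero]
    have hv0 : v ≠ 0 := by rintro h; rw [h] at hvn; simp at hvn
    have hrange : ∀ x, inner ℂ v (f x) = 0 := by
      intro x
      rw [← LinearMap.adjoint_inner_left, hfv, inner_zero_left]
    set W : Submodule ℂ E := (ℂ ∙ v)ᗮ with hW
    have hmemW : ∀ x, x ∈ W ↔ inner ℂ v x = 0 := fun x =>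
      Submodule.mem_orthogonal_singleton_iff_inner_right
    have hWfin : finrank ℂ W = n := by
      have : Fact (finrank ℂ E = n + 1) := ⟨hE⟩
      exact Submodule.finrank_orthogonal_span_singleton hv0
    let g : W →ₗ[ℂ] W := f.restrict (fun x _ => (hmemW _).2 (hrange x))
    have hg : ∀ (k : ℕ) (x : W), (((g ^ k) x : W) : E) = (f ^ k) x := by
      intro k
      induction k with
      | zero => intro x; simp
      | succ k ihk =>
        intro x
        rw [pow_succ, pow_succ, Module.End.mul_apply, Module.End.mul_apply, ihk]
        rfl
    obtain ⟨b, hb, hbf⟩ := ih W hWfin g ⟨m, by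
      ext x
      rw [hg, hm]; simp⟩
    have hbv : ∀ i, inner ℂ v (b i : E) = 0 := fun i => (hmemW _).1 (b i).2
    refine ⟨Fin.snoc (α := fun _ => E) (fun i => (b i : E)) v, ?_, ?_⟩
    · constructor
      · intro i
        refine Fin.lastCases ?_ (fun i => ?_) i
        · simpa using hvn
        · simpa using hb.1 i
      · intro i j hij
        induction i using Fin.lastCases with
        | last =>
          induction j using Fin.lastCases with
          | last => exact absurd rfl hij
          | cast j => simpa using hbv j
        | cast i =>
          induction j using Fin.lastCases with
          | last =>
            simp only [Fin.snoc_castSucc, Fin.snoc_last]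
            rw [← inner_conj_symm, hbv, map_zero]
          | cast j =>
            simp only [Fin.snoc_castSucc]
            exact hb.2 (fun h => hij (by rw [h]))
    · intro i j hij
      induction i using Fin.lastCases with
      | last => simpa using hrange _
      | cast i =>
        induction j using Fin.lastCases with
        | last => exact absurd hij (not_le.2 (Fin.castSucc_lt_last i))
        | cast j =>
          simp only [Fin.snoc_castSucc]
          exact hbf i j (by simpa using hij)

/-- Schur triangularization of a nilpotent matrix. -/
theorem exists_unitary_strictUpper {n : ℕ} [NeZero n] {A : Matrix (Fin n) (Fin n) ℂ}
    (hA : IsNilpotent A) : ∃ U ∈ unitaryGroup (Fin n) ℂ, ∃ T : Matrix (Fin n) (Fin n) ℂ,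
      (∀ i j, j ≤ i → T i j = 0) ∧ A = U * T * star U := by
  have hf : IsNilpotent (toEuclideanLin A) := by
    obtain ⟨m, hm⟩ := hA
    refine ⟨m, ?_⟩
    have h : ∀ (k : ℕ) (x : EuclideanSpace ℂ (Fin n)),
        ((toEuclideanLin A) ^ k) x = WithLp.toLp 2 ((A ^ k) *ᵥ x.ofLp) := by
      intro k
      induction k with
      | zero => intro x; simp
      | succ k ihk =>
        intro x
        rw [pow_succ, Module.End.mul_apply, ihk, pow_succ, ← mulVec_mulVec]
        rfl
    ext x : 1
    rw [h, hm]; simp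
  obtain ⟨b, hb, hbf⟩ := exists_orthonormalBasis_strictUpper n (EuclideanSpace ℂ (Fin n))
    (by simp) (toEuclideanLin A) hf
  let U : Matrix (Fin n) (Fin n) ℂ := Matrix.of fun i j => b j i
  have hinner : ∀ x y : EuclideanSpace ℂ (Fin n), inner ℂ x y = star x.ofLp ⬝ᵥ y.ofLp := by
    intro x y
    rw [EuclideanSpace.inner_eq_star_dotProduct, dotProduct_comm]
  have hU' : star U * U = 1 := by
    ext i j
    have := orthonormal_iff_ite.1 hb i j
    rw [hinner] at this
    rw [one_apply, ← this]
    rfl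
  have hU : U ∈ unitaryGroup (Fin n) ℂ := mem_unitaryGroup_iff'.2 hU'
  have hU'' : U * star U = 1 := mem_unitaryGroup_iff.1 hU
  refine ⟨U, hU, star U * A * U, fun i j hij => ?_, ?_⟩
  · have := hbf i j hij
    rw [hinner] at this
    rw [← this, Matrix.mul_assoc]
    rfl
  · calc A = (U * star U) * A * (U * star U) := by rw [hU'', Matrix.one_mul, Matrix.mul_one]
      _ = _ := by simp only [Matrix.mul_assoc]

end Triangularization

/-! ### Vanishing 3×3 minors of the pencil. -/

section Minors

/-- A matrix whose kernel contains two linearly independent vectors. -/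
def HasKernelPair {n : Type*} [Fintype n] (N : Matrix n n ℂ) : Prop :=
  ∃ v w : n → ℂ, N *ᵥ v = 0 ∧ N *ᵥ w = 0 ∧ ∀ s t : ℂ, s • v + t • w = 0 → s = 0 ∧ t = 0

/-- Proportional unit vectors differ by a phase and give the same value of the quadratic form. -/
theorem FlatDir.hasKernelPair {n : Type*} [Fintype n] [DecidableEq n] {A : Matrix n n ℂ} {k : ℝ}
    {z : ℂ} (h : FlatDir A k z) : HasKernelPair (pencil A k z) := by
  obtain ⟨-, v, w, hv, hw, nv, nw, hq⟩ := h
  refine ⟨v, w, nv, nw, fun s t hst => ?_⟩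
  have hs : s = 0 := by
    by_contra hs
    apply hq
    have h1 : v = (-(t / s)) • w := by
      have h2 : s⁻¹ • (s • v + t • w) = 0 := by rw [hst, smul_zero]
      rw [smul_add, smul_smul, inv_mul_cancel₀ hs, one_smul, smul_smul] at h2
      rw [neg_smul, eq_neg_of_add_eq_zero_left h2, div_eq_inv_mul]
    have h3 : ((‖-(t / s)‖ ^ 2 : ℝ) : ℂ) = 1 := by
      have h4 := hv
      rw [h1] at h4
      simp only [star_smul, smul_dotProduct, dotProduct_smul, smul_eq_mul, hw, mul_one,
        RCLike.star_def] at h4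
      rw [Complex.mul_conj, Complex.normSq_eq_norm_sq] at h4
      exact h4
    rw [h1, quad_smul_vec, h3, one_mul]
  subst hs
  refine ⟨rfl, ?_⟩
  rw [zero_smul, zero_add] at hst
  refine (smul_eq_zero.1 hst).resolve_right ?_
  rintro rfl
  simp at hw

/-- Some nonzero combination of the two kernel vectors vanishes in coordinate `j`; dropping that
coordinate leaves a nonzero kernel vector of the submatrix. -/
theorem HasKernelPair.det_submatrix_eq_zero {m : ℕ} {N : Matrix (Fin (m + 1)) (Fin (m + 1)) ℂ}
    (h : HasKernelPair N) (i j : Fin (m + 1)) :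
    (N.submatrix i.succAbove j.succAbove).det = 0 := by
  obtain ⟨v, w, hv, hw, hi⟩ := h
  obtain ⟨u, hu, hNu, huj⟩ : ∃ u, u ≠ 0 ∧ N *ᵥ u = 0 ∧ u j = 0 := by
    by_cases hvj : v j = 0
    · refine ⟨v, ?_, hv, hvj⟩
      rintro rfl
      exact one_ne_zero (hi 1 0 (by simp)).1
    · refine ⟨w j • v + (-v j) • w, fun h0 => hvj (neg_eq_zero.1 (hi _ _ h0).2), ?_, ?_⟩
      · rw [mulVec_add, mulVec_smul, mulVec_smul, hv, hw]; simp
      · simp; ring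
  refine exists_mulVec_eq_zero_iff.1 ⟨fun l => u (j.succAbove l), ?_, ?_⟩
  · intro h0
    apply hu
    ext l
    induction l using Fin.succAboveCases j with
    | x => exact huj
    | p l => exact congrFun h0 l
  · ext l
    have := congrFun hNu (i.succAbove l)
    simp only [mulVec, dotProduct, Fin.sum_univ_succAbove _ j, huj, mul_zero, zero_add] at this
    simpa [mulVec, dotProduct] using this

/-- The strictly upper triangular `4 × 4` matrix with the given entries. -/
def upper (a b c e f g : ℂ) : Matrix (Fin 4) (Fin 4) ℂ :=
  !![0, a, b, c; 0, 0, e, f; 0, 0, 0, g; 0, 0, 0, 0]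

theorem pencil_upper (a b c e f g : ℂ) (k : ℝ) (z : ℂ) :
    pencil (upper a b c e f g) k z =
      !![(k : ℂ), z * a, z * b, z * c;
        conj z * conj a, (k : ℂ), z * e, z * f;
        conj z * conj b, conj z * conj e, (k : ℂ), z * g;
        conj z * conj c, conj z * conj f, conj z * conj g, (k : ℂ)] := by
  ext i j
  fin_cases i <;> fin_cases j <;> simp [pencil, upper, Matrix.conjTranspose_apply]

/-- Relation by relation, these are the minors deleting (row, column) `(3,2)`, `(0,2)`, `(1,3)`,
`(0,3)`, `(0,1)`, `(3,3)`, `(2,2)`, with powers of `z` removed by `z z̄ = 1` so that each is affine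
in `z` and `z̄`. -/
theorem upper_minors {a b c e f g : ℂ} {k : ℝ} {z : ℂ} (hz : ‖z‖ = 1)
    (h : HasKernelPair (pencil (upper a b c e f g) k z)) :
    z * ((k ^ 2 - a * conj a) * g + a * f * conj b) + conj z * (c * conj a * conj e) =
        k * (f * conj e + c * conj b) ∧
    z * (k * g * conj c) + conj z * (k * conj a * conj e) =
        conj a * g * conj f + (k ^ 2 - f * conj f) * conj b + f * conj c * conj e ∧
    z * (k * a * conj c) + conj z * (k * conj e * conj g) =
        a * conj b * conj g + (k ^ 2 - b * conj b) * conj f + b * conj c * conj e ∧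
    z * ((k ^ 2 - e * conj e) * conj c + e * conj b * conj f) +
        conj z * (conj a * conj e * conj g) = k * (conj a * conj f + conj b * conj g) ∧
    z * (e * g * conj c) + conj z * (conj a * (k ^ 2 - g * conj g) + f * conj b * conj g) =
        k * (e * conj b + f * conj c) ∧
    k ^ 3 - k * (a * conj a + b * conj b + e * conj e) + z * (a * e * conj b) +
        conj z * (conj a * conj e * b) = 0 ∧
    k ^ 3 - k * (a * conj a + c * conj c + f * conj f) + z * (a * f * conj c) +
        conj z * (conj a * conj f * c) = 0 := by
  have hz1 := conj_mul_self_of_norm_eq_one hz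
  rw [pencil_upper] at h
  have m := fun i j => h.det_submatrix_eq_zero i j
  have m32 := m 3 2
  have m02 := m 0 2
  have m13 := m 1 3
  have m03 := m 0 3
  have m01 := m 0 1
  have m33 := m 3 3
  have m22 := m 2 2
  clear m h
  simp [det_fin_three, Fin.succAbove, Fin.lt_def] at m32 m02 m13 m03 m01 m33 m22
  generalize conj z = z' at *
  generalize conj a = a' at *
  generalize conj b = b' at *
  generalize conj c = c' at *
  generalize conj e = e' at *
  generalize conj f = f' at *
  generalize conj g = g' at *
  generalize (k : ℂ) = k at *
  refine ⟨?_, ?_, ?_, ?_, ?_, ?_, ?_⟩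
  · grind
  · grind
  · grind
  · grind
  · grind
  · grind
  · grind

end Minors

/-! ### Necessity: reduction to the normal form. -/

section NormalForm

/-- If `A² = 0`, the support lines of the numerical range contain only one of its points. -/
theorem FlatDir.sq_ne_zero {n : Type*} [Fintype n] [DecidableEq n] {A : Matrix n n ℂ} {k : ℝ}
    (hk : k ≠ 0) {z : ℂ} (hz : ‖z‖ = 1) (h : FlatDir A k z) : A * A ≠ 0 := by
  intro hA
  obtain ⟨hp, v, w, hv, hw, nv, nw, hq⟩ := h
  have hA' : Aᴴ * Aᴴ = 0 := by rw [← conjTranspose_mul, hA, conjTranspose_zero]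
  have key : ∀ v : n → ℂ, star v ⬝ᵥ v = 1 → pencil A k z *ᵥ v = 0 →
      z * quad A v = ((-(k / 2) : ℝ) : ℂ) := by
    intro v hv nv
    have hre := (pencil_mulVec_eq_zero_iff hp hv).1 nv
    -- Applying `A*` to `H v = 0` kills the term with `A*²`; pairing with `v` shows that `z⟨Av,v⟩`
    -- is real, and its real part is already fixed on the support line.
    have h1 : (k : ℂ) * quad Aᴴ v + z * (star (A *ᵥ v) ⬝ᵥ (A *ᵥ v)) = 0 := by
      have h2 : star v ⬝ᵥ Aᴴ *ᵥ (pencil A k z *ᵥ v) = 0 := by rw [nv]; simp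
      simp only [pencil, add_mulVec, mulVec_add, smul_mulVec, mulVec_smul, one_mulVec,
        mulVec_mulVec, hA', zero_mulVec, smul_zero, add_zero, dotProduct_add, dotProduct_smul,
        smul_eq_mul] at h2
      rw [← h2, star_mulVec, quad, ← mulVec_mulVec, dotProduct_mulVec _ Aᴴ (A *ᵥ v)]
    rw [quad_conjTranspose, star_dotProduct_self_eq] at h1
    have h3 : conj (z * quad A v) = ((-(∑ i, ‖(A *ᵥ v) i‖ ^ 2) / k : ℝ) : ℂ) := by
      have hk' : (k : ℂ) ≠ 0 := by exact_mod_cast hk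
      rw [map_mul, Complex.ofReal_div, Complex.ofReal_neg, eq_div_iff hk']
      linear_combination conj z * h1 -
        ((∑ i, ‖(A *ᵥ v) i‖ ^ 2 : ℝ) : ℂ) * conj_mul_self_of_norm_eq_one hz
    apply Complex.ext
    · rw [hre, Complex.ofReal_re]
    · have := congrArg Complex.im h3
      rw [Complex.conj_im, Complex.ofReal_im] at this
      rw [Complex.ofReal_im]; linarith
  have hz0 : z ≠ 0 := by rintro rfl; simp at hz
  exact hq (mul_left_cancel₀ hz0 ((key v hv nv).trans (key w hw nw).symm))

theorem upper_sq_eq_zero {a b c e f g : ℂ} (h₁ : a * e = 0) (h₂ : e * g = 0)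
    (h₃ : a * f + b * g = 0) : upper a b c e f g * upper a b c e f g = 0 := by
  ext i j
  fin_cases i <;> fin_cases j <;> simp [upper, Matrix.mul_apply, Fin.sum_univ_four, h₁, h₂, h₃]

theorem flatDir_unitary_conj {n : Type*} [Fintype n] [DecidableEq n] {U A : Matrix n n ℂ}
    (hU : U ∈ unitaryGroup n ℂ) {k : ℝ} {z : ℂ} (h : FlatDir (U * A * star U) k z) :
    FlatDir A k z := by
  obtain ⟨hp, v, w, hv, hw, nv, nw, hq⟩ := h
  have hU1 : star U * U = 1 := mem_unitaryGroup_iff'.1 hU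
  have hP : pencil A k z = star U * pencil (U * A * star U) k z * U := by
    rw [pencil_unitary_conj hU, Matrix.mul_assoc, Matrix.mul_assoc, Matrix.mul_assoc, hU1,
      Matrix.mul_one, ← Matrix.mul_assoc, hU1, Matrix.one_mul]
  have hU2 : U * star U = 1 := mem_unitaryGroup_iff.1 hU
  have hker : ∀ v, pencil (U * A * star U) k z *ᵥ v = 0 → pencil A k z *ᵥ (star U *ᵥ v) = 0 := by
    intro v hv
    rw [hP, mulVec_mulVec, Matrix.mul_assoc, hU2, Matrix.mul_one, ← mulVec_mulVec, hv, mulVec_zero]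
  refine ⟨?_, star U *ᵥ v, star U *ᵥ w, ?_, ?_, hker v nv, hker w nw, ?_⟩
  · rw [hP]
    exact hp.conjTranspose_mul_mul_same U
  · rw [star_mulVec_unitary (Unitary.star_mem hU), hv]
  · rw [star_mulVec_unitary (Unitary.star_mem hU), hw]
  · rwa [quad_unitary_conj, quad_unitary_conj] at hq

/-- Subtracting the two equations leaves `(z - z̄)(P - Q) = 0`. This is where the second flat
direction enters. -/
theorem eq_of_linear_pair {z P Q R : ℂ} (hz : z.im ≠ 0) (h₁ : z * P + conj z * Q = R)
    (h₂ : conj z * P + z * Q = R) : P = Q ∧ 2 * (z.re : ℂ) * Q = R := by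
  have h3 : (z - conj z) * (P - Q) = 0 := by linear_combination h₁ - h₂
  have h4 : z - conj z ≠ 0 := by
    rw [Complex.sub_conj]
    simp [hz]
  have h5 : P = Q := sub_eq_zero.1 ((mul_eq_zero.1 h3).resolve_left h4)
  refine ⟨h5, ?_⟩
  rw [← h₁, h5, ← add_mul, Complex.add_conj]
  push_cast; ring

/-- Normal form, up to unitary equivalence, of a nilpotent matrix with two flat directions. -/
theorem upper_entries {a b c e f g : ℂ} {k : ℝ} (hk : 0 < k) {ω : ℂ} (hω : ‖ω‖ = 1)
    (him : ω.im ≠ 0) (h₁ : FlatDir (upper a b c e f g) k ω)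
    (h₂ : FlatDir (upper a b c e f g) k (conj ω)) :
    a ≠ 0 ∧ e ≠ 0 ∧ g ≠ 0 ∧
    conj a * conj e = g * conj c ∧ a * conj c = conj e * conj g ∧
    2 * (ω.re : ℂ) * (c * conj a * conj e) = k * (f * conj e + c * conj b) ∧
    2 * (ω.re : ℂ) * (conj a * conj e * conj g) = k * (conj a * conj f + conj b * conj g) ∧
    k ^ 3 - k * (a * conj a + b * conj b + e * conj e) + ω * (a * e * conj b) +
        conj ω * (conj a * conj e * b) = 0 := by
  have hω' : ‖conj ω‖ = 1 := by rw [RCLike.norm_conj, hω]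
  have hsq := h₁.sq_ne_zero hk.ne' hω
  obtain ⟨m1, m2, m3, m4, m5, m6, -⟩ := upper_minors hω h₁.hasKernelPair
  obtain ⟨n1, n2, n3, n4, n5, -, -⟩ := upper_minors hω' h₂.hasKernelPair
  rw [Complex.conj_conj] at n1 n2 n3 n4 n5
  obtain ⟨p1, q1⟩ := eq_of_linear_pair him m1 n1
  obtain ⟨p2, -⟩ := eq_of_linear_pair him m2 n2
  obtain ⟨p3, -⟩ := eq_of_linear_pair him m3 n3
  obtain ⟨p4, q4⟩ := eq_of_linear_pair him m4 n4
  obtain ⟨p5, -⟩ := eq_of_linear_pair him m5 n5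
  have hk' : (k : ℂ) ≠ 0 := by exact_mod_cast hk.ne'
  have r2 : conj a * conj e = g * conj c :=
    mul_left_cancel₀ hk' (by linear_combination -p2)
  have r3 : a * conj c = conj e * conj g :=
    mul_left_cancel₀ hk' (by linear_combination p3)
  -- The relations make `a` and `g` vanish together, and `e = 0` gives `af + bg = 0`; either way the
  -- square would be zero.
  have hsq' : ¬ (a * e = 0 ∧ e * g = 0 ∧ a * f + b * g = 0) := fun h =>
    hsq (upper_sq_eq_zero h.1 h.2.1 h.2.2)
  have hag : ¬ (a = 0 ∧ g = 0) := by
    rintro ⟨rfl, rfl⟩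
    exact hsq' (by simp)
  have ha : a ≠ 0 := by
    rintro rfl
    refine hag ⟨rfl, ?_⟩
    simpa [hk'] using p1
  have hg : g ≠ 0 := by
    rintro rfl
    refine hag ⟨?_, rfl⟩
    simpa [hk'] using p5
  have he : e ≠ 0 := by
    rintro rfl
    refine hsq' ⟨by simp, by simp, ?_⟩
    have : conj (a * f + b * g) = 0 := by
      rw [map_add, map_mul, map_mul]
      exact mul_left_cancel₀ hk' (by rw [← q4]; simp)
    simpa using congrArg conj this
  exact ⟨ha, he, hg, r2, r3, q1, q4, m6⟩

/-- A diagonal unitary fixes the phases of the superdiagonal. Then `xy = g c̄` and `x c̄ = y g` give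
`g = x` and `c = y`; the two relations for `f` and `b̄` make both real, and the principal minor
gives the product. -/
theorem upper_normal_form {a b c e f g : ℂ} {k : ℝ} (hk : 0 < k) {ω : ℂ} (hω : ‖ω‖ = 1)
    (him : ω.im ≠ 0) (h₁ : FlatDir (upper a b c e f g) k ω)
    (h₂ : FlatDir (upper a b c e f g) k (conj ω)) :
    ∃ U ∈ unitaryGroup (Fin 4) ℂ, ∃ x y δ₁ δ₂ : ℝ, 0 < x ∧ 0 < y ∧
      k * (δ₁ + δ₂) = 2 * ω.re * x * y ∧ δ₁ * δ₂ = x ^ 2 + y ^ 2 - k ^ 2 ∧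
      upper a b c e f g = U * formMatrix x y δ₁ δ₂ * star U := by
  obtain ⟨ha, he, hg, -⟩ := upper_entries hk hω him h₁ h₂
  have hphase : ∀ w : ℂ, w ≠ 0 → ∃ p : ℂ, conj p * p = 1 ∧ w * p = ‖w‖ := by
    intro w hw
    have hw' : (‖w‖ : ℂ) ≠ 0 := by simpa using hw
    have hc : w * conj w = ‖w‖ ^ 2 := by
      rw [Complex.mul_conj, Complex.normSq_eq_norm_sq]; push_cast; rfl
    refine ⟨conj w / ‖w‖, ?_, ?_⟩
    · rw [map_div₀, Complex.conj_conj, Complex.conj_ofReal]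
      field_simp
      exact hc
    · field_simp
      exact hc
  obtain ⟨p, hp, hpa⟩ := hphase a ha
  obtain ⟨q, hq, hqe⟩ := hphase e he
  obtain ⟨r, hr, hrg⟩ := hphase g hg
  let U : Matrix (Fin 4) (Fin 4) ℂ := diagonal ![1, p, p * q, p * q * r]
  have hU : U ∈ unitaryGroup (Fin 4) ℂ := by
    rw [mem_unitaryGroup_iff', star_eq_conjTranspose]
    simp only [U, diagonal_conjTranspose, diagonal_mul_diagonal]
    rw [← diagonal_one]
    congr 1
    ext i
    fin_cases i <;> simp
    · exact hp
    · linear_combination conj q * q * hp + hq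
    · linear_combination conj q * q * conj r * r * hp + conj r * r * hq + hr
  have hform : upper a b c e f g = U * upper ‖a‖ (b * (p * q)) (c * (p * q * r)) ‖e‖
      (f * (q * r)) ‖g‖ * star U := by
    ext i j
    fin_cases i <;> fin_cases j <;>
      simp [U, upper, star_eq_conjTranspose, diagonal_conjTranspose]
    · rw [← hpa]; linear_combination -a * hp
    · linear_combination -b * conj q * q * hp - b * hq
    · linear_combination -c * conj q * q * conj r * r * hp - c * conj r * r * hq - c * hr
    · rw [← hqe]; linear_combination -e * conj q * q * hp - e * hq
    · linear_combination -f * conj q * q * conj r * r * hp - f * conj r * r * hq - f * hr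
    · rw [← hrg]; linear_combination -g * conj q * q * conj r * r * hp - g * conj r * r * hq - g * hr
  -- The entry relations are derived afresh for the phase-normalized matrix, whose superdiagonal is
  -- real.
  rw [hform] at h₁ h₂
  obtain ⟨-, -, -, e1, e2, e3, e4, e5⟩ := upper_entries hk hω him (flatDir_unitary_conj hU h₁)
    (flatDir_unitary_conj hU h₂)
  rw [hform]
  clear hform h₁ h₂
  generalize b * (p * q) = b at *
  generalize c * (p * q * r) = c at *
  generalize f * (q * r) = f at *
  have hx : 0 < ‖a‖ := norm_pos_iff.2 ha
  have hy : 0 < ‖e‖ := norm_pos_iff.2 he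
  have hg0 : 0 < ‖g‖ := norm_pos_iff.2 hg
  generalize ‖a‖ = x at *
  generalize ‖e‖ = y at *
  generalize ‖g‖ = g at *
  simp only [Complex.conj_ofReal] at e1 e2 e3 e4 e5
  have hx' : (x : ℂ) ≠ 0 := by exact_mod_cast hx.ne'
  have hy' : (y : ℂ) ≠ 0 := by exact_mod_cast hy.ne'
  have hg' : (g : ℂ) ≠ 0 := by exact_mod_cast hg0.ne'
  have hk' : (k : ℂ) ≠ 0 := by exact_mod_cast hk.ne'
  have hgx : g = x := by
    have h1 : ((y * g ^ 2 : ℝ) : ℂ) = ((y * x ^ 2 : ℝ) : ℂ) := by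
      push_cast
      linear_combination -(g : ℂ) * e2 - (x : ℂ) * e1
    have h2 : y * g ^ 2 = y * x ^ 2 := by exact_mod_cast h1
    have h3 := mul_left_cancel₀ hy.ne' h2
    exact (sq_eq_sq₀ hg0.le hx.le).1 h3
  subst hgx
  have hc : c = y := by
    have h1 : conj c = y := mul_left_cancel₀ hg' (by linear_combination e2)
    rw [← Complex.conj_conj c, h1, Complex.conj_ofReal]
  subst hc
  have f1 : k * (f + conj b) = 2 * ω.re * g * y :=
    mul_left_cancel₀ hy' (by linear_combination -e3)
  have f2 : k * (conj f + conj b) = 2 * ω.re * g * y :=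
    mul_left_cancel₀ hg' (by linear_combination -e4)
  have hf : conj f = f := by
    have := mul_left_cancel₀ hk' (f2.trans f1.symm)
    exact add_right_cancel this
  obtain ⟨δ₂, rfl⟩ := Complex.conj_eq_iff_real.1 hf
  have hb : conj b = b := by
    have h1 : conj b = ((2 * ω.re * g * y / k - δ₂ : ℝ) : ℂ) := by
      push_cast
      field_simp
      linear_combination f1
    refine h1.trans ?_
    rw [← Complex.conj_ofReal, ← h1, Complex.conj_conj]
  obtain ⟨δ₁, rfl⟩ := Complex.conj_eq_iff_real.1 hb
  simp only [Complex.conj_ofReal] at f1 e5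
  have g1 : k * (δ₁ + δ₂) = 2 * ω.re * g * y := by
    have : k * (δ₂ + δ₁) = 2 * ω.re * g * y := by exact_mod_cast f1
    linarith
  have hωω : ω + conj ω = ((2 * ω.re : ℝ) : ℂ) := by rw [Complex.add_conj]
  have g2 : k ^ 3 - k * (g * g + δ₁ * δ₁ + y * y) + 2 * ω.re * (g * y * δ₁) = 0 := by
    have : (k : ℂ) ^ 3 - k * (g * g + δ₁ * δ₁ + y * y) + ((2 * ω.re : ℝ) : ℂ) * (g * y * δ₁) = 0 := by
      rw [← hωω]; linear_combination e5
    exact_mod_cast this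
  refine ⟨U, hU, g, y, δ₁, δ₂, hx, hy, g1, ?_, rfl⟩
  refine mul_left_cancel₀ hk.ne' ?_
  linear_combination δ₁ * g1 + g2

theorem formMatrix_eq_upper (x y δ₁ δ₂ : ℝ) :
    formMatrix x y δ₁ δ₂ = upper x δ₁ y y δ₂ x := rfl

theorem le_of_pencil_posSemidef {a b c e f g : ℂ} {k : ℝ} {z : ℂ} (hz : ‖z‖ = 1) {x : ℝ}
    (ha : a = x) (h : (pencil (upper a b c e f g) k z).PosSemidef) : x ≤ k := by
  -- This vector tests the leading 2×2 block and returns `2k - 2x`.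
  have h1 := h.dotProduct_mulVec_nonneg ![z, -1, 0, 0]
  have hz1 := conj_mul_self_of_norm_eq_one hz
  rw [pencil_upper, ha] at h1
  have h2 : (0 : ℂ) ≤ ((2 * k - 2 * x : ℝ) : ℂ) := by
    convert h1 using 1
    simp [dotProduct, mulVec, Fin.sum_univ_four]
    linear_combination (2 * x - k : ℂ) * hz1
  rw [Complex.zero_le_real] at h2
  linarith

/-- Sum and product make `δ₁, δ₂` the roots of the stated quadratic; its discriminant equals `(2dδ₁
- xyS)²`, and nonnegativity is the bound on `y`. -/
theorem exists_hasForm {T : Matrix (Fin 4) (Fin 4) ℂ} (hT : ∀ i j, j ≤ i → T i j = 0) {d θ : ℝ}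
    (hd : 0 < d) (hS : Real.sin (θ / 2) ^ 2 < 1) {ω : ℂ} (hω : ‖ω‖ = 1)
    (hre : ω.re = Real.sin (θ / 2)) (him : ω.im ≠ 0) (h₁ : FlatDir T (2 * d) ω)
    (h₂ : FlatDir T (2 * d) (conj ω)) :
    ∃ U ∈ unitaryGroup (Fin 4) ℂ, ∃ x y δ₁ δ₂ : ℝ, (0 < x ∧ x < 2 * d) ∧
      (0 < y ∧ y ≤ √((16 * d ^ 4 - 4 * d ^ 2 * x ^ 2) /
        (4 * d ^ 2 - x ^ 2 * Real.sin (θ / 2) ^ 2))) ∧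
      ((δ₁ = deltaRoot d θ x y 1 ∧ δ₂ = deltaRoot d θ x y (-1)) ∨
        (δ₁ = deltaRoot d θ x y (-1) ∧ δ₂ = deltaRoot d θ x y 1)) ∧
      T = U * formMatrix x y δ₁ δ₂ * star U := by
  have hTu : T = upper (T 0 1) (T 0 2) (T 0 3) (T 1 2) (T 1 3) (T 2 3) := by
    ext i j
    fin_cases i <;> fin_cases j <;> simp [upper] <;> exact hT _ _ (by decide)
  have h₁' := h₁
  rw [hTu] at h₁ h₂ ⊢
  obtain ⟨U, hU, x, y, δ₁, δ₂, hx, hy, hs, hp, hTU⟩ :=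
    upper_normal_form (by positivity) hω him h₁ h₂
  rw [hTU] at h₁
  have hxle : x ≤ 2 * d := le_of_pencil_posSemidef hω rfl (flatDir_unitary_conj hU h₁).1
  rw [hre] at hs
  set S := Real.sin (θ / 2) with hSdef
  have hδ : (2 * d * δ₁ - x * y * S) ^ 2 =
      x ^ 2 * y ^ 2 * S ^ 2 + 16 * d ^ 4 - 4 * d ^ 2 * (x ^ 2 + y ^ 2) := by
    have hδ₂ : d * δ₂ = x * y * S - d * δ₁ := by linarith
    linear_combination (-4 * d ^ 2) * hp + 4 * d * δ₁ * hδ₂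
  have hdisc : y ^ 2 * (4 * d ^ 2 - x ^ 2 * S ^ 2) ≤ 16 * d ^ 4 - 4 * d ^ 2 * x ^ 2 := by
    nlinarith [sq_nonneg (2 * d * δ₁ - x * y * S)]
  -- At `x = 2d` the discriminant inequality would read `4d²y²(1 - S²) ≤ 0`.
  have hxd : x < 2 * d := by
    refine lt_of_le_of_ne hxle fun h => ?_
    subst h
    have : 0 < (2 * d) ^ 2 * y ^ 2 * (1 - S ^ 2) := by
      have := sub_pos.2 hS
      positivity
    nlinarith
  have hpos : 0 < 4 * d ^ 2 - x ^ 2 * S ^ 2 := by nlinarith [sq_nonneg S, sq_nonneg x]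
  refine ⟨U, hU, x, y, δ₁, δ₂, ⟨hx, hxd⟩, ⟨hy, ?_⟩, ?_, hTU⟩
  · apply Real.le_sqrt_of_sq_le
    rw [le_div_iff₀ hpos]
    exact hdisc
  · unfold deltaRoot
    rw [← hSdef, ← hδ, Real.sqrt_sq_eq_abs]
    rcases abs_cases (2 * d * δ₁ - x * y * S) with ⟨h, -⟩ | ⟨h, -⟩
    · left
      rw [h]
      constructor
      · field_simp; ring
      · field_simp; linarith
    · right
      rw [h]
      constructor
      · field_simp; ring
      · field_simp; linarith

end NormalForm

/-! ### Algebraic identities for the model matrix. -/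

section FormMatrix

/-- Completing squares with pivots `k` and `(k² - x²)/k`, after which the remaining 2×2 Schur
complement vanishes by the sum and product relations. -/
theorem quad_pencil_formMatrix {x y δ₁ δ₂ k : ℝ} {ω : ℂ} (hω : ‖ω‖ = 1)
    (hs : k * (δ₁ + δ₂) = 2 * ω.re * x * y) (hp : δ₁ * δ₂ = x ^ 2 + y ^ 2 - k ^ 2)
    (v : Fin 4 → ℂ) :
    ((k ^ 2 - x ^ 2) * k : ℂ) * quad (pencil (formMatrix x y δ₁ δ₂) k ω) v =
      (k ^ 2 - x ^ 2) * ((‖k * v 0 + ω * x * v 1 + ω * δ₁ * v 2 + ω * y * v 3‖ ^ 2 : ℝ) : ℂ) +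
      ((‖(k ^ 2 - x ^ 2) * v 1 + (k * ω * y - x * δ₁) * v 2 + (k * ω * δ₂ - x * y) * v 3‖ ^ 2 : ℝ)
        : ℂ) := by
  have hz1 := conj_mul_self_of_norm_eq_one hω
  have hs' : (k : ℂ) * (δ₁ + δ₂) = (ω + conj ω) * x * y := by
    rw [Complex.add_conj]
    exact_mod_cast hs
  have hp' : (δ₁ : ℂ) * δ₂ = x ^ 2 + y ^ 2 - k ^ 2 := by exact_mod_cast hp
  rw [← Complex.normSq_eq_norm_sq, ← Complex.normSq_eq_norm_sq, ← Complex.mul_conj,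
    ← Complex.mul_conj, formMatrix_eq_upper, pencil_upper]
  simp [quad, dotProduct, mulVec, Fin.sum_univ_four]
  generalize conj (v 0) = a' at *
  generalize conj (v 1) = b' at *
  generalize conj (v 2) = c' at *
  generalize conj (v 3) = d' at *
  generalize v 0 = a at *
  generalize v 1 = b at *
  generalize v 2 = c at *
  generalize v 3 = d at *
  generalize conj ω = ω' at *
  generalize (k : ℂ) = k at *
  generalize (x : ℂ) = x at *
  generalize (y : ℂ) = y at *
  generalize (δ₁ : ℂ) = δ₁ at *
  generalize (δ₂ : ℂ) = δ₂ at *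
  clear hs hp hω
  grind

/-- A vector in the kernel of the pencil of `formMatrix x y δ₁ δ₂`. -/
def kernelVec (x y δ₁ δ₂ k : ℝ) (ω s t : ℂ) : Fin 4 → ℂ :=
  -- The two squares are set to zero and solved for the first two coordinates; the factor `k² - x²`
  -- on the last two clears denominators.
  ![s * (ω * (ω * x * y - k * δ₁)) + t * (ω * (ω * x * δ₂ - k * y)),
    s * (x * δ₁ - k * ω * y) + t * (x * y - k * ω * δ₂), s * (k ^ 2 - x ^ 2), t * (k ^ 2 - x ^ 2)]

theorem kernelVec_quad {x y δ₁ δ₂ k : ℝ} {ω : ℂ} (hω : ‖ω‖ = 1)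
    (hs : k * (δ₁ + δ₂) = 2 * ω.re * x * y) (hp : δ₁ * δ₂ = x ^ 2 + y ^ 2 - k ^ 2) (s t : ℂ) :
    k * (star (kernelVec x y δ₁ δ₂ k ω s t) ⬝ᵥ kernelVec x y δ₁ δ₂ k ω s t) =
      2 * (k ^ 2 - x ^ 2) * (k ^ 2 * (k * (conj s * s) + k * (conj t * t) + ω * x * (conj s * t) +
        conj ω * x * (conj t * s)) - ω.re * x * y * (δ₁ * (conj s * s) + δ₂ * (conj t * t) +
          y * (conj s * t + conj t * s))) ∧
    ω * quad (formMatrix x y δ₁ δ₂) (kernelVec x y δ₁ δ₂ k ω s t) =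
      -(k / 2) * (star (kernelVec x y δ₁ δ₂ k ω s t) ⬝ᵥ kernelVec x y δ₁ δ₂ k ω s t) +
      Complex.I * ω.im * (k ^ 2 - x ^ 2) * x * y * (δ₁ * (conj s * s) + δ₂ * (conj t * t) +
          y * (conj s * t + conj t * s)) := by
  have hz1 := conj_mul_self_of_norm_eq_one hω
  have hre : (ω.re : ℂ) = (ω + conj ω) / 2 := by rw [Complex.add_conj]; push_cast; ring
  have him : Complex.I * ω.im = (ω - conj ω) / 2 := by
    rw [Complex.sub_conj]; push_cast; ring
  have hs' : (k : ℂ) * (δ₁ + δ₂) = (ω + conj ω) * x * y := by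
    rw [Complex.add_conj]
    exact_mod_cast hs
  have hp' : (δ₁ : ℂ) * δ₂ = x ^ 2 + y ^ 2 - k ^ 2 := by exact_mod_cast hp
  rw [hre, him, formMatrix_eq_upper]
  simp [quad, dotProduct, mulVec, Fin.sum_univ_four, upper, kernelVec]
  clear hs hp hω hre him
  generalize conj s = s' at *
  generalize conj t = t' at *
  generalize conj ω = ω' at *
  generalize (k : ℂ) = k at *
  generalize (x : ℂ) = x at *
  generalize (y : ℂ) = y at *
  generalize (δ₁ : ℂ) = δ₁ at *
  generalize (δ₂ : ℂ) = δ₂ at *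
  constructor
  · grind
  · grind

end FormMatrix

/-! ### Faces of the numerical range of the model matrix. -/

section FormFaces

/-- The parameters of `formMatrix x y δ₁ δ₂` satisfy the relations that force flat portions at
distance `k / 2` from the origin, with normals having real part `S`. -/
structure FormParams (x y δ₁ δ₂ k S : ℝ) : Prop where
  x_pos : 0 < x
  x_lt : x < k
  y_pos : 0 < y
  y_lt : y < k
  sq_lt : S ^ 2 < 1
  sum : k * (δ₁ + δ₂) = 2 * S * x * y
  prod : δ₁ * δ₂ = x ^ 2 + y ^ 2 - k ^ 2

variable {x y δ₁ δ₂ k S : ℝ}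

theorem FormParams.k_pos (h : FormParams x y δ₁ δ₂ k S) : 0 < k := h.x_pos.trans h.x_lt

theorem FormParams.n_pos (h : FormParams x y δ₁ δ₂ k S) : 0 < k ^ 2 - x ^ 2 := by
  nlinarith [h.x_pos, h.x_lt]

theorem FormParams.mul_bounds (h : FormParams x y δ₁ δ₂ k S) :
    -k ^ 2 < S * x * y ∧ S * x * y < k ^ 2 := by
  have hxy : 0 < x * y := mul_pos h.x_pos h.y_pos
  have hxyk : x * y < k ^ 2 := by nlinarith [h.x_pos, h.x_lt, h.y_pos, h.y_lt]
  obtain ⟨h1, h2⟩ := abs_lt.1 ((sq_lt_one_iff_abs_lt_one S).1 h.sq_lt)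
  constructor <;> nlinarith

theorem FormParams.δ_bounds (h : FormParams x y δ₁ δ₂ k S) : -k < δ₁ ∧ δ₁ < k := by
  have hk := h.k_pos
  obtain ⟨h1, h2⟩ := h.mul_bounds
  have hxy : 0 < x * y := mul_pos h.x_pos h.y_pos
  obtain ⟨h3, h4⟩ := abs_lt.1 ((sq_lt_one_iff_abs_lt_one S).1 h.sq_lt)
  have hs : δ₁ + δ₂ < 2 * k := by nlinarith [h.sum]
  have hs' : -(2 * k) < δ₁ + δ₂ := by nlinarith [h.sum]
  -- The products equal `x² + y² ∓ 2Sxy`, positive as `|S| < 1`; with the bounds on the sum, both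
  -- factors are positive.
  have e1 : 0 < (k - δ₁) * (k - δ₂) := by nlinarith [h.sum, h.prod, sq_nonneg (x - y)]
  have e2 : 0 < (k + δ₁) * (k + δ₂) := by nlinarith [h.sum, h.prod, sq_nonneg (x - y)]
  constructor
  · by_contra hc
    nlinarith
  · by_contra hc
    nlinarith

theorem FormParams.posSemidef (h : FormParams x y δ₁ δ₂ k S) {ω : ℂ} (hω : ‖ω‖ = 1)
    (hre : ω.re = S) : (pencil (formMatrix x y δ₁ δ₂) k ω).PosSemidef := by
  refine PosSemidef.of_dotProduct_mulVec_nonneg (pencil_isHermitian _ _ _) fun v => ?_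
  change 0 ≤ quad _ v
  subst hre
  have h1 := quad_pencil_formMatrix hω h.sum h.prod v
  have hn := h.n_pos
  have hk := h.k_pos
  set R : ℝ := (k ^ 2 - x ^ 2) *
    ‖k * v 0 + ω * x * v 1 + ω * δ₁ * v 2 + ω * y * v 3‖ ^ 2 +
    ‖(k ^ 2 - x ^ 2) * v 1 + (k * ω * y - x * δ₁) * v 2 + (k * ω * δ₂ - x * y) * v 3‖ ^ 2 with hR
  have h2 : quad (pencil (formMatrix x y δ₁ δ₂) k ω) v = ((R / ((k ^ 2 - x ^ 2) * k) : ℝ) : ℂ) := by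
    have hne : (((k ^ 2 - x ^ 2) * k : ℝ) : ℂ) ≠ 0 := by
      exact_mod_cast (mul_pos hn hk).ne'
    rw [Complex.ofReal_div, eq_div_iff hne, mul_comm]
    rw [hR]
    push_cast
    push_cast at h1
    exact h1
  rw [h2, Complex.zero_le_real]
  positivity

theorem FormParams.mulVec_kernelVec (h : FormParams x y δ₁ δ₂ k S) {ω : ℂ} (hω : ‖ω‖ = 1)
    (hre : ω.re = S) (s t : ℂ) :
    pencil (formMatrix x y δ₁ δ₂) k ω *ᵥ kernelVec x y δ₁ δ₂ k ω s t = 0 := by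
  rw [← (h.posSemidef hω hre).dotProduct_mulVec_zero_iff]
  change quad _ _ = 0
  subst hre
  have h1 := quad_pencil_formMatrix hω h.sum h.prod (kernelVec x y δ₁ δ₂ k ω s t)
  have e1 : (k : ℂ) * kernelVec x y δ₁ δ₂ k ω s t 0 + ω * x * kernelVec x y δ₁ δ₂ k ω s t 1 +
      ω * δ₁ * kernelVec x y δ₁ δ₂ k ω s t 2 + ω * y * kernelVec x y δ₁ δ₂ k ω s t 3 = 0 := by
    simp [kernelVec]; ring
  have e2 : ((k : ℂ) ^ 2 - x ^ 2) * kernelVec x y δ₁ δ₂ k ω s t 1 + (k * ω * y - x * δ₁) *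
      kernelVec x y δ₁ δ₂ k ω s t 2 + (k * ω * δ₂ - x * y) * kernelVec x y δ₁ δ₂ k ω s t 3 = 0 := by
    simp [kernelVec]; ring
  have hne : (((k : ℂ) ^ 2 - x ^ 2) * k : ℂ) ≠ 0 := by
    exact_mod_cast (mul_pos h.n_pos h.k_pos).ne'
  rw [e1, e2] at h1
  simp only [norm_zero, ne_eq, OfNat.ofNat_ne_zero, not_false_eq_true, zero_pow,
    Complex.ofReal_zero, mul_zero, add_zero] at h1
  exact (mul_eq_zero.1 h1).resolve_left hne

theorem FormParams.eq_kernelVec (h : FormParams x y δ₁ δ₂ k S) {ω : ℂ} (hω : ‖ω‖ = 1)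
    (hre : ω.re = S) {v : Fin 4 → ℂ} (hv : pencil (formMatrix x y δ₁ δ₂) k ω *ᵥ v = 0) :
    ∃ s t, v = kernelVec x y δ₁ δ₂ k ω s t := by
  subst hre
  have h1 := quad_pencil_formMatrix hω h.sum h.prod v
  have hn := h.n_pos
  have hk : (k : ℂ) ≠ 0 := by exact_mod_cast h.k_pos.ne'
  have hn' : ((k : ℂ) ^ 2 - x ^ 2) ≠ 0 := by exact_mod_cast hn.ne'
  rw [quad, hv, dotProduct_zero, mul_zero] at h1
  have h2 : 0 = (k ^ 2 - x ^ 2) *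
    ‖k * v 0 + ω * x * v 1 + ω * δ₁ * v 2 + ω * y * v 3‖ ^ 2 +
    ‖(k ^ 2 - x ^ 2) * v 1 + (k * ω * y - x * δ₁) * v 2 + (k * ω * δ₂ - x * y) * v 3‖ ^ 2 := by
    exact_mod_cast h1
  have p1 := mul_nonneg hn.le
    (sq_nonneg ‖k * v 0 + ω * x * v 1 + ω * δ₁ * v 2 + ω * y * v 3‖)
  have p2 := sq_nonneg
    ‖(k ^ 2 - x ^ 2) * v 1 + (k * ω * y - x * δ₁) * v 2 + (k * ω * δ₂ - x * y) * v 3‖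
  have q2 : (k ^ 2 - x ^ 2) * v 1 + (k * ω * y - x * δ₁) * v 2 + (k * ω * δ₂ - x * y) * v 3 = 0 :=
    norm_eq_zero.1 (pow_eq_zero_iff two_ne_zero |>.1 (by linarith))
  have q1 : k * v 0 + ω * x * v 1 + ω * δ₁ * v 2 + ω * y * v 3 = 0 := by
    have : (k ^ 2 - x ^ 2) * ‖k * v 0 + ω * x * v 1 + ω * δ₁ * v 2 + ω * y * v 3‖ ^ 2 = 0 := by
      linarith
    exact norm_eq_zero.1 (pow_eq_zero_iff two_ne_zero |>.1
      ((mul_eq_zero.1 this).resolve_left hn.ne'))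
  refine ⟨v 2 / (k ^ 2 - x ^ 2), v 3 / (k ^ 2 - x ^ 2), ?_⟩
  ext i
  fin_cases i <;> simp [kernelVec]
  · field_simp
    refine mul_left_cancel₀ hk ?_
    linear_combination (k ^ 2 - x ^ 2 : ℂ) * q1 - ω * x * q2
  · refine mul_left_cancel₀ hn' ?_
    field_simp
    linear_combination q2
  · field_simp
  · field_simp

/-- `E` and `F` are Hermitian forms in `(s, t)`. The matrix of `E - F` has determinant `(k-δ₁)(k-δ₂)
- |ωx-y|² = 0`, and likewise for `E + F`, so each is a single square up to a positive factor. With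
the normalization this confines `F`. -/
theorem FormParams.kernelVec_values (h : FormParams x y δ₁ δ₂ k S) {ω : ℂ} (hω : ‖ω‖ = 1)
    (hre : ω.re = S) (s t : ℂ)
    (hu : star (kernelVec x y δ₁ δ₂ k ω s t) ⬝ᵥ kernelVec x y δ₁ δ₂ k ω s t = 1) :
    ∃ E F : ℝ, k = 2 * (k ^ 2 - x ^ 2) * (k ^ 2 * E - S * x * y * F) ∧
      ω * quad (formMatrix x y δ₁ δ₂) (kernelVec x y δ₁ δ₂ k ω s t) =
        ⟨-(k / 2), ω.im * x * y * ((k ^ 2 - x ^ 2) * F)⟩ ∧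
      (k - δ₁) * (E - F) = ‖(k - δ₁) * s + (ω * x - y) * t‖ ^ 2 ∧
      (k + δ₁) * (E + F) = ‖(k + δ₁) * s + (ω * x + y) * t‖ ^ 2 := by
  subst hre
  obtain ⟨h1, h2⟩ := kernelVec_quad hω h.sum h.prod s t
  rw [hu] at h1 h2
  set E : ℝ := k * ‖s‖ ^ 2 + k * ‖t‖ ^ 2 + 2 * x * (ω * (conj s * t)).re with hE
  set F : ℝ := δ₁ * ‖s‖ ^ 2 + δ₂ * ‖t‖ ^ 2 + 2 * y * (conj s * t).re with hF
  have ns : ((‖s‖ ^ 2 : ℝ) : ℂ) = conj s * s := by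
    rw [mul_comm, Complex.mul_conj, Complex.normSq_eq_norm_sq]
  have nt : ((‖t‖ ^ 2 : ℝ) : ℂ) = conj t * t := by
    rw [mul_comm, Complex.mul_conj, Complex.normSq_eq_norm_sq]
  have c1 : ((2 * (ω * (conj s * t)).re : ℝ) : ℂ) = ω * (conj s * t) + conj ω * (conj t * s) := by
    rw [← Complex.add_conj]
    simp only [map_mul, Complex.conj_conj]; ring
  have c2 : ((2 * (conj s * t).re : ℝ) : ℂ) = conj s * t + conj t * s := by
    rw [← Complex.add_conj]
    simp only [map_mul, Complex.conj_conj]; ring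
  have eE : (E : ℂ) = k * (conj s * s) + k * (conj t * t) + ω * x * (conj s * t) +
        conj ω * x * (conj t * s) := by
    have : E = k * ‖s‖ ^ 2 + k * ‖t‖ ^ 2 + x * (2 * (ω * (conj s * t)).re) := by rw [hE]; ring
    rw [this, Complex.ofReal_add, Complex.ofReal_add, Complex.ofReal_mul, Complex.ofReal_mul,
      Complex.ofReal_mul, ns, nt, c1]
    ring
  have eF : (F : ℂ) = δ₁ * (conj s * s) + δ₂ * (conj t * t) + y * (conj s * t + conj t * s) := by
    have : F = δ₁ * ‖s‖ ^ 2 + δ₂ * ‖t‖ ^ 2 + y * (2 * (conj s * t).re) := by rw [hF]; ring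
    rw [this, Complex.ofReal_add, Complex.ofReal_add, Complex.ofReal_mul, Complex.ofReal_mul,
      Complex.ofReal_mul, ns, nt, c2]
  rw [← eE, ← eF] at h1
  rw [← eF] at h2
  have hz1 := conj_mul_self_of_norm_eq_one hω
  have hs' : (k : ℂ) * (δ₁ + δ₂) = (ω + conj ω) * x * y := by
    rw [Complex.add_conj]
    exact_mod_cast h.sum
  have hp' : (δ₁ : ℂ) * δ₂ = x ^ 2 + y ^ 2 - k ^ 2 := by exact_mod_cast h.prod
  refine ⟨E, F, ?_, ?_, ?_, ?_⟩
  · rw [mul_one] at h1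
    exact_mod_cast h1
  · rw [h2]
    have : Complex.I * ω.im * (k ^ 2 - x ^ 2) * x * y * F =
        ((ω.im * x * y * ((k ^ 2 - x ^ 2) * F) : ℝ) : ℂ) * Complex.I := by push_cast; ring
    rw [this, mul_one]
    generalize ω.im * x * y * ((k ^ 2 - x ^ 2) * F) = X
    apply Complex.ext <;> simp
  · rw [← Complex.ofReal_inj, Complex.ofReal_mul, Complex.ofReal_sub, Complex.ofReal_sub, eE, eF,
      ← Complex.normSq_eq_norm_sq, ← Complex.mul_conj]
    simp only [map_add, map_mul, map_sub, Complex.conj_ofReal]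
    clear hE hF eE eF h1 h2 c1 c2 ns nt hu
    grind
  · rw [← Complex.ofReal_inj, Complex.ofReal_mul, Complex.ofReal_add, Complex.ofReal_add, eE, eF,
      ← Complex.normSq_eq_norm_sq, ← Complex.mul_conj]
    simp only [map_add, map_mul, Complex.conj_ofReal]
    clear hE hF eE eF h1 h2 c1 c2 ns nt hu
    grind

theorem kernelVec_smul (ω c s t : ℂ) :
    c • kernelVec x y δ₁ δ₂ k ω s t = kernelVec x y δ₁ δ₂ k ω (c * s) (c * t) := by
  ext i
  fin_cases i <;> simp [kernelVec] <;> ring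

theorem FormParams.exists_unit_kernelVec (h : FormParams x y δ₁ δ₂ k S) {ω : ℂ} {s t : ℂ}
    (ht : t ≠ 0) : ∃ c : ℂ,
      star (kernelVec x y δ₁ δ₂ k ω (c * s) (c * t)) ⬝ᵥ
        kernelVec x y δ₁ δ₂ k ω (c * s) (c * t) = 1 := by
  have hne : kernelVec x y δ₁ δ₂ k ω s t ≠ 0 := by
    intro h0
    have h3 := congrFun h0 3
    have hn' : ((k : ℂ) ^ 2 - x ^ 2) ≠ 0 := by exact_mod_cast h.n_pos.ne'
    simp [kernelVec, ht, hn'] at h3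
  obtain ⟨r, -, -, hr⟩ := exists_unit_smul hne
  exact ⟨_, by rw [← kernelVec_smul]; exact hr⟩

theorem FormParams.values_mem (h : FormParams x y δ₁ δ₂ k S) {ω : ℂ} (hω : ‖ω‖ = 1)
    (hre : ω.re = S) {v : Fin 4 → ℂ} (hv : pencil (formMatrix x y δ₁ δ₂) k ω *ᵥ v = 0)
    (hu : star v ⬝ᵥ v = 1) :
    ∃ f : ℝ, -(k / (2 * (k ^ 2 + S * x * y))) ≤ f ∧ f ≤ k / (2 * (k ^ 2 - S * x * y)) ∧
      ω * quad (formMatrix x y δ₁ δ₂) v = ⟨-(k / 2), ω.im * x * y * f⟩ := by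
  obtain ⟨s, t, rfl⟩ := h.eq_kernelVec hω hre hv
  obtain ⟨E, F, h1, h2, h3, h4⟩ := h.kernelVec_values hω hre s t hu
  obtain ⟨b1, b2⟩ := h.δ_bounds
  obtain ⟨a1, a2⟩ := h.mul_bounds
  have hn := h.n_pos
  have hk := h.k_pos
  have e1 : 0 ≤ E - F := by
    by_contra hc
    nlinarith [sq_nonneg ‖(k - δ₁) * s + (ω * x - y) * t‖,
      mul_pos (sub_pos.2 b2) (neg_pos.2 (not_le.1 hc))]
  have e2 : 0 ≤ E + F := by
    by_contra hc
    nlinarith [sq_nonneg ‖(k + δ₁) * s + (ω * x + y) * t‖,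
      mul_pos (show 0 < k + δ₁ by linarith) (neg_pos.2 (not_le.1 hc))]
  have hnk : 0 < (k ^ 2 - x ^ 2) * k ^ 2 := by positivity
  refine ⟨_, ?_, ?_, h2⟩
  · rw [neg_le, le_div_iff₀ (by linarith)]
    nlinarith [mul_nonneg hnk.le e2]
  · rw [le_div_iff₀ (by linarith)]
    nlinarith [mul_nonneg hnk.le e1]

/-- The bounds of `FormParams.values_mem` are sharp: the extremes occur where the square for `E -
F`, respectively `E + F`, vanishes, and this determines `(s, t)` up to scale. -/
theorem FormParams.exists_extremal (h : FormParams x y δ₁ δ₂ k S) {ω : ℂ} (hω : ‖ω‖ = 1)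
    (hre : ω.re = S) :
    (∃ v, pencil (formMatrix x y δ₁ δ₂) k ω *ᵥ v = 0 ∧ star v ⬝ᵥ v = 1 ∧
      ω * quad (formMatrix x y δ₁ δ₂) v =
        ⟨-(k / 2), ω.im * x * y * (k / (2 * (k ^ 2 - S * x * y)))⟩) ∧
    (∃ v, pencil (formMatrix x y δ₁ δ₂) k ω *ᵥ v = 0 ∧ star v ⬝ᵥ v = 1 ∧
      ω * quad (formMatrix x y δ₁ δ₂) v =
        ⟨-(k / 2), ω.im * x * y * (-(k / (2 * (k ^ 2 + S * x * y))))⟩) := by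
  obtain ⟨b1, b2⟩ := h.δ_bounds
  obtain ⟨a1, a2⟩ := h.mul_bounds
  have b1' : 0 < k + δ₁ := by linarith
  have b2' : 0 < k - δ₁ := by linarith
  have t1 : ((k : ℂ) - δ₁) ≠ 0 := by exact_mod_cast b2'.ne'
  have t2 : ((k : ℂ) + δ₁) ≠ 0 := by exact_mod_cast b1'.ne'
  constructor
  · obtain ⟨c, hc⟩ := h.exists_unit_kernelVec (ω := ω) (s := -(ω * x - y)) t1
    refine ⟨_, h.mulVec_kernelVec hω hre _ _, hc, ?_⟩
    obtain ⟨E, F, h1, h2, h3, -⟩ := h.kernelVec_values hω hre _ _ hc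
    have h0 : ((k : ℂ) - δ₁) * (c * -(ω * x - y)) + (ω * x - y) * (c * (k - δ₁)) = 0 := by ring
    rw [h0, norm_zero, zero_pow two_ne_zero] at h3
    have hEF : E = F := by
      have := (mul_eq_zero.1 h3).resolve_left b2'.ne'
      linarith
    have : (k ^ 2 - x ^ 2) * F = k / (2 * (k ^ 2 - S * x * y)) := by
      have hne : 2 * (k ^ 2 - S * x * y) ≠ 0 := by linarith
      rw [eq_div_iff hne]
      rw [hEF] at h1
      linarith
    rw [h2, this]
  · obtain ⟨c, hc⟩ := h.exists_unit_kernelVec (ω := ω) (s := -(ω * x + y)) t2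
    refine ⟨_, h.mulVec_kernelVec hω hre _ _, hc, ?_⟩
    obtain ⟨E, F, h1, h2, -, h3⟩ := h.kernelVec_values hω hre _ _ hc
    have h0 : ((k : ℂ) + δ₁) * (c * -(ω * x + y)) + (ω * x + y) * (c * (k + δ₁)) = 0 := by ring
    rw [h0, norm_zero, zero_pow two_ne_zero] at h3
    have hEF : E = -F := by
      have := (mul_eq_zero.1 h3).resolve_left b1'.ne'
      linarith
    have : (k ^ 2 - x ^ 2) * F = -(k / (2 * (k ^ 2 + S * x * y))) := by
      have hne : 2 * (k ^ 2 + S * x * y) ≠ 0 := by linarith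
      rw [eq_neg_iff_add_eq_zero, ← eq_neg_iff_add_eq_zero, ← neg_eq_iff_eq_neg, eq_div_iff hne]
      rw [hEF] at h1
      linarith
    rw [h2, this]

/-- Real flat directions do not occur. -/
theorem FormParams.false_of_real (h : FormParams x y δ₁ δ₂ k S) (hS : 0 < S) {c l : ℝ}
    (hc : c ^ 2 = 1) (hl : 0 ≤ l) (hxy : x = y) (hlδ : l = c * δ₁)
    (hm : l ^ 3 - l * (x ^ 2 + y ^ 2 + δ₂ ^ 2) + 2 * c * (x * y * δ₂) = 0)
    (ht : 0 ≤ 4 * l + 2 * c * (δ₁ + δ₂ - 2 * x - 2 * y)) : False := by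
  obtain ⟨hx, hxk, -, -, hS2, hs, hp⟩ := h
  have hk : 0 < k := hx.trans hxk
  subst hxy
  have hS1 : S < 1 := by nlinarith
  -- Substituting `l = cδ₁` and `c² = 1` makes the principal minor factor. If `δ₁ = δ₂`, then `kδ₁ =
  -- Sx²` forces `c = 1`, and the test inequality gives `x ≤ δ₁`, impossible since `Sx < k`. The
  -- other factor gives `Sδ₁ = k` and `δ₁² = k²`, so `S² = 1`.
  have h1 : (δ₁ - δ₂) * (δ₁ * (δ₁ + δ₂) - 2 * x ^ 2) = 0 := by
    have hc0 : c ≠ 0 := by rintro rfl; norm_num at hc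
    refine mul_left_cancel₀ hc0 ?_
    rw [hlδ] at hm
    linear_combination hm - c * δ₁ ^ 3 * hc
  rcases mul_eq_zero.1 h1 with h2 | h2
  · obtain rfl : δ₁ = δ₂ := by linarith
    have h3 : k * δ₁ = S * x ^ 2 := by linarith
    have hδ : 0 < δ₁ := by
      by_contra hneg
      have : 0 < S * x ^ 2 := by positivity
      nlinarith
    have hcpos : 0 ≤ c := by
      by_contra hneg
      nlinarith
    have hc1 : c = 1 := by nlinarith
    subst hc1
    have h4 : x ≤ δ₁ := by linarith
    nlinarith [mul_le_mul_of_nonneg_left h4 hk.le]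
  · have h3 : S * δ₁ = k := by
      have h4 : x ^ 2 * (S * δ₁) = x ^ 2 * k := by linear_combination k / 2 * h2 - δ₁ / 2 * hs
      exact mul_left_cancel₀ (by positivity) h4
    have h5 : δ₁ ^ 2 = k ^ 2 := by linear_combination h2 - hp
    have h6 : S ^ 2 * k ^ 2 = k ^ 2 := by rw [← h5, ← mul_pow, h3, h5]
    nlinarith [pow_pos hk 2]

theorem FormParams.symm (h : FormParams x y δ₁ δ₂ k S) : FormParams x y δ₂ δ₁ k S :=
  ⟨h.x_pos, h.x_lt, h.y_pos, h.y_lt, h.sq_lt, by rw [add_comm]; exact h.sum,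
    by rw [mul_comm]; exact h.prod⟩

/-- All entries are real, so the minors split into real and imaginary parts. For non-real `z` the
imaginary part of the first yields `l² = x² + y² - δ₁δ₂ = k²`, and its real part then yields `Re z =
S`. For `z = ±1` the minors force `x = y` and `l = zδ₁` or `l = zδ₂`, which
`FormParams.false_of_real` rules out. -/
theorem FormParams.flatDir_unique (h : FormParams x y δ₁ δ₂ k S) (hS : 0 < S) {z : ℂ}
    (hz : ‖z‖ = 1) {l : ℝ} (hf : FlatDir (formMatrix x y δ₁ δ₂) l z) : l = k ∧ z.re = S := by
  have hpsd := hf.1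
  rw [formMatrix_eq_upper] at hf hpsd
  obtain ⟨m1, -, -, m4, -, m6, m7⟩ := upper_minors hz hf.hasKernelPair
  have hl : 0 ≤ l := h.x_pos.le.trans (le_of_pencil_posSemidef hz rfl hpsd)
  have ht : 0 ≤ 4 * l + 2 * z.re * (δ₁ + δ₂ - 2 * x - 2 * y) := by
    -- This test vector supplies the one inequality needed when `z` is real and `δ₁ = δ₂`, where the
    -- minor equations alone give no contradiction.
    have h1 := hpsd.dotProduct_mulVec_nonneg ![1, -1, 1, -1]
    rw [pencil_upper] at h1
    have h2 : (0 : ℂ) ≤ ((4 * l + 2 * z.re * (δ₁ + δ₂ - 2 * x - 2 * y) : ℝ) : ℂ) := by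
      convert h1 using 1
      have : ((2 * z.re : ℝ) : ℂ) = z + conj z := by rw [Complex.add_conj]
      have h3 : ((4 * l + 2 * z.re * (δ₁ + δ₂ - 2 * x - 2 * y) : ℝ) : ℂ) =
          4 * l + (z + conj z) * (δ₁ + δ₂ - 2 * x - 2 * y) := by
        rw [← this]; push_cast; ring
      rw [h3]
      simp [dotProduct, mulVec, Fin.sum_univ_four]
      ring
    rwa [Complex.zero_le_real] at h2
  have hcs : z.re ^ 2 + z.im ^ 2 = 1 := by
    have h3 := Complex.sq_norm z
    rw [hz, Complex.normSq_apply] at h3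
    linarith
  have ofre : ∀ {P Q R : ℝ}, z * (P : ℂ) + conj z * (Q : ℂ) = (R : ℂ) →
      z.re * (P + Q) = R ∧ z.im * (P - Q) = 0 := by
    intro P Q R h
    have h1 := congrArg Complex.re h
    have h2 := congrArg Complex.im h
    simp at h1 h2
    constructor <;> linarith
  obtain ⟨r1, i1⟩ := ofre (P := (l ^ 2 - x ^ 2) * x + x * δ₁ * δ₂) (Q := x * y ^ 2)
    (R := l * y * (δ₁ + δ₂)) (by
      simp only [Complex.conj_ofReal] at m1
      push_cast; linear_combination m1)
  obtain ⟨r4, -⟩ := ofre (P := (l ^ 2 - y ^ 2) * y + y * δ₁ * δ₂) (Q := x ^ 2 * y)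
    (R := l * x * (δ₁ + δ₂)) (by
      simp only [Complex.conj_ofReal] at m4
      push_cast; linear_combination m4)
  obtain ⟨r6, -⟩ := ofre (P := x * y * δ₁) (Q := x * y * δ₁)
    (R := -(l ^ 3 - l * (x ^ 2 + δ₁ ^ 2 + y ^ 2))) (by
      simp only [Complex.conj_ofReal] at m6
      push_cast; linear_combination m6)
  obtain ⟨r7, -⟩ := ofre (P := x * y * δ₂) (Q := x * y * δ₂)
    (R := -(l ^ 3 - l * (x ^ 2 + y ^ 2 + δ₂ ^ 2))) (by
      simp only [Complex.conj_ofReal] at m7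
      push_cast; linear_combination m7)
  have hx := h.x_pos
  have hy := h.y_pos
  have hk := h.k_pos
  have hre_of : l = k → z.re = S := by
    rintro rfl
    have h1 : x * y ^ 2 * z.re = x * y ^ 2 * S := by
      linear_combination r1 / 2 - z.re * x / 2 * h.prod + y / 2 * h.sum
    exact mul_left_cancel₀ (by positivity) h1
  have hlk_of : l ^ 2 = k ^ 2 → l = k := fun hsq => (sq_eq_sq₀ hl hk.le).1 hsq
  by_cases him : z.im = 0
  · exfalso
    rw [him] at hcs
    have hc : z.re ^ 2 = 1 := by linarith
    have hne : l ^ 2 ≠ k ^ 2 := by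
      intro hsq
      have := hre_of (hlk_of hsq)
      rw [this] at hc
      exact h.sq_lt.ne hc
    have hc0 : z.re ≠ 0 := by
      intro h0; rw [h0] at hc; norm_num at hc
    have h1 : (x ^ 2 - y ^ 2) * (l ^ 2 - k ^ 2) = 0 := by
      refine mul_left_cancel₀ hc0 ?_
      linear_combination x * r1 - y * r4 - z.re * (x ^ 2 - y ^ 2) * h.prod
    have hxy : x = y := by
      have h2 := (mul_eq_zero.1 h1).resolve_right (sub_ne_zero.2 hne)
      exact (sq_eq_sq₀ hx.le hy.le).1 (by linarith)
    have h3 : (l - z.re * δ₁) * (l - z.re * δ₂) = 0 := by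
      refine mul_left_cancel₀ (mul_ne_zero hc0 hx.ne') ?_
      subst hxy
      linear_combination r1 + (z.re * x * δ₁ * δ₂ - l * x * (δ₁ + δ₂)) * hc
    rcases mul_eq_zero.1 h3 with h4 | h4
    · exact h.false_of_real hS hc hl hxy (sub_eq_zero.1 h4) (by linear_combination r7) ht
    · exact h.symm.false_of_real hS hc hl hxy (sub_eq_zero.1 h4) (by linear_combination r6)
        (by linarith)
  · have h1 := (mul_eq_zero.1 i1).resolve_left him
    have hlk : l = k := by
      apply hlk_of
      have : x * l ^ 2 = x * k ^ 2 := by linear_combination h1 - x * h.prod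
      exact mul_left_cancel₀ hx.ne' this
    exact ⟨hlk, hre_of hlk⟩

end FormFaces

/-! ### Assembly of the equivalence and the length formula. -/

section Main

theorem IsFace.flatDir {n : Type*} [Fintype n] [DecidableEq n] {A : Matrix n n ℂ} {z : ℂ}
    {l : ℝ} {p q : ℂ} (hpq : p ≠ q) (h : IsFace (numericalRange A) z l p q) :
    FlatDir A (-2 * l) z := by
  have hpsd : (pencil A (-2 * l) z).PosSemidef := by
    rw [pencil_posSemidef_iff]
    intro w hw
    have := h.1 w hw
    linarith
  obtain ⟨v, hv, rfl⟩ := mem_numericalRange_iff.1 h.left_mem.1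
  obtain ⟨w, hw, rfl⟩ := mem_numericalRange_iff.1 h.right_mem.1
  refine ⟨hpsd, v, w, hv, hw, (pencil_mulVec_eq_zero_iff hpsd hv).2 ?_,
    (pencil_mulVec_eq_zero_iff hpsd hw).2 ?_, hpq⟩
  · rw [h.left_mem.2]; ring
  · rw [h.right_mem.2]; ring

theorem flatDir_smul_iff {n : Type*} [Fintype n] [DecidableEq n] {A : Matrix n n ℂ} {k : ℝ}
    {z c : ℂ} (hc : c ≠ 0) : FlatDir (c • A) k z ↔ FlatDir A k (z * c) := by
  simp only [FlatDir, pencil_smul, quad_smul, ne_eq, mul_eq_mul_left_iff, hc, or_false]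

theorem zero_mem_numericalRange {n : Type*} [Fintype n] [DecidableEq n] [Nonempty n]
    {A : Matrix n n ℂ} (hA : IsNilpotent A) : (0 : ℂ) ∈ numericalRange A := by
  obtain ⟨m, hm⟩ := hA
  have hdet : A.det = 0 := by
    have h : A.det ^ m = 0 := by rw [← det_pow, hm, det_zero]
    exact IsReduced.eq_zero _ ⟨m, h⟩
  obtain ⟨v, hv, hAv⟩ := exists_mulVec_eq_zero_iff.2 hdet
  obtain ⟨r, -, -, hu⟩ := exists_unit_smul hv
  refine mem_numericalRange_iff.2 ⟨_, hu, ?_⟩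
  rw [quad_smul_vec, quad, hAv, dotProduct_zero, mul_zero]

theorem exists_exp_eq {c : ℂ} (hc : ‖c‖ = 1) :
    ∃ t : ℝ, (0 ≤ t ∧ t < 2 * Real.pi) ∧ Complex.exp (t * Complex.I) = c := by
  have h := Complex.norm_mul_exp_arg_mul_I c
  rw [hc, Complex.ofReal_one, one_mul] at h
  have h1 := Complex.neg_pi_lt_arg c
  have h2 := Complex.arg_le_pi c
  have hpi := Real.pi_pos
  by_cases h0 : 0 ≤ c.arg
  · exact ⟨c.arg, ⟨h0, by linarith⟩, h⟩
  · refine ⟨c.arg + 2 * Real.pi, ⟨by linarith, by linarith⟩, ?_⟩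
    push_cast
    rw [add_mul, Complex.exp_add, h, Complex.exp_two_pi_mul_I, mul_one]

theorem HasForm.exists_params {d θ x y : ℝ} (hd : 0 < d) (hS : Real.sin (θ / 2) ^ 2 < 1)
    {A : Matrix (Fin 4) (Fin 4) ℂ} (h : HasForm d θ x y A) :
    ∃ δ₁ δ₂ : ℝ, FormParams x y δ₁ δ₂ (2 * d) (Real.sin (θ / 2)) ∧ ∃ c : ℂ, ‖c‖ = 1 ∧
      ∃ U ∈ unitaryGroup (Fin 4) ℂ, A = U * (c • formMatrix x y δ₁ δ₂) * star U := by
  obtain ⟨⟨hx, hxd⟩, ⟨hy, hyb⟩, t, δ₁, δ₂, -, hδ, U, hU, hA⟩ := h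
  refine ⟨δ₁, δ₂, ?_, Complex.exp (t * Complex.I), Complex.norm_exp_ofReal_mul_I t, U, hU, hA⟩
  unfold deltaRoot at hδ
  set S := Real.sin (θ / 2) with hSdef
  have hpos : 0 < 4 * d ^ 2 - x ^ 2 * S ^ 2 := by nlinarith [sq_nonneg S, sq_nonneg x]
  have hnum : 0 ≤ 16 * d ^ 4 - 4 * d ^ 2 * x ^ 2 := by
    have : 0 ≤ 4 * d ^ 2 * ((2 * d - x) * (2 * d + x)) := by
      have := sub_pos.2 hxd
      positivity
    nlinarith
  have hy2 : y ^ 2 * (4 * d ^ 2 - x ^ 2 * S ^ 2) ≤ 16 * d ^ 4 - 4 * d ^ 2 * x ^ 2 := by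
    rw [← le_div_iff₀ hpos]
    calc y ^ 2 ≤ √((16 * d ^ 4 - 4 * d ^ 2 * x ^ 2) / (4 * d ^ 2 - x ^ 2 * S ^ 2)) ^ 2 :=
          pow_le_pow_left₀ hy.le hyb 2
      _ = _ := Real.sq_sqrt (div_nonneg hnum hpos.le)
  have hdisc : 0 ≤ x ^ 2 * y ^ 2 * S ^ 2 + 16 * d ^ 4 - 4 * d ^ 2 * (x ^ 2 + y ^ 2) := by
    nlinarith
  have hsq := Real.mul_self_sqrt hdisc
  set D := √(x ^ 2 * y ^ 2 * S ^ 2 + 16 * d ^ 4 - 4 * d ^ 2 * (x ^ 2 + y ^ 2))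
  -- If `y ≥ 2d`, the bound on `y` would give `4d²x²(1 - S²) ≤ 0`.
  have hyd : y < 2 * d := by
    by_contra hc
    have h1 : (2 * d) ^ 2 ≤ y ^ 2 := pow_le_pow_left₀ (by positivity) (not_lt.1 hc) 2
    have h2 := mul_le_mul_of_nonneg_right h1 hpos.le
    have h3 : 0 < d ^ 2 * x ^ 2 * (1 - S ^ 2) := by
      have := sub_pos.2 hS
      positivity
    nlinarith
  have hsum : 2 * d * (δ₁ + δ₂) = 2 * S * x * y := by
    rcases hδ with ⟨rfl, rfl⟩ | ⟨rfl, rfl⟩ <;> · field_simp; ring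
  have hprod : δ₁ * δ₂ = x ^ 2 + y ^ 2 - (2 * d) ^ 2 := by
    have h0 : 4 * d ^ 2 * (δ₁ * δ₂) = (x * y * S) ^ 2 - D * D := by
      rcases hδ with ⟨rfl, rfl⟩ | ⟨rfl, rfl⟩ <;> · field_simp; ring
    rw [hsq] at h0
    refine mul_left_cancel₀ (show 4 * d ^ 2 ≠ 0 by positivity) ?_
    rw [h0]; ring
  exact ⟨hx, hxd, hy, hyd, hS, hsum, hprod⟩

theorem HasTwoFlatPortions.exists_hasForm {θ d : ℝ} (hθ : 0 < θ ∧ θ < Real.pi) (hd : 0 < d)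
    {A : Matrix (Fin 4) (Fin 4) ℂ} (hA : IsNilpotent A)
    (h : HasTwoFlatPortions (numericalRange A) d θ) : ∃ x y : ℝ, HasForm d θ x y A := by
  obtain ⟨z₁, z₂, p₁, q₁, p₂, q₂, hz₁, hz₂, hpq₁, hpq₂, f₁, f₂, hz⟩ :=
    h.exists_isFace (convex_numericalRange A) (isCompact_numericalRange A).isClosed
      (zero_mem_numericalRange hA) hθ
  have g₁ := f₁.flatDir hpq₁
  have g₂ := f₂.flatDir hpq₂
  rw [show -2 * -d = 2 * d by ring] at g₁ g₂
  have hC : 0 < Real.cos (θ / 2) :=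
    Real.cos_pos_of_mem_Ioo ⟨by linarith [hθ.1, Real.pi_pos], by linarith [hθ.2]⟩
  have hS : 0 < Real.sin (θ / 2) :=
    Real.sin_pos_of_pos_of_lt_pi (by linarith [hθ.1]) (by linarith [hθ.2, Real.pi_pos])
  have hSC := Real.sin_sq_add_cos_sq (θ / 2)
  have hcosθ : -Real.cos θ = Real.sin (θ / 2) ^ 2 - Real.cos (θ / 2) ^ 2 := by
    have := Real.cos_two_mul (θ / 2)
    rw [mul_div_cancel₀ _ two_ne_zero] at this
    rw [this]; linarith
  set ω : ℂ := ⟨Real.sin (θ / 2), Real.cos (θ / 2)⟩ with hω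
  have hωn : ‖ω‖ = 1 := by
    have : ‖ω‖ ^ 2 = 1 := by
      rw [Complex.sq_norm, Complex.normSq_apply]
      linarith
    exact (pow_eq_one_iff_of_nonneg (norm_nonneg _) two_ne_zero).1 this
  have hωω := conj_mul_self_of_norm_eq_one hωn
  -- The real part `-cos θ = Re ω²` and the sign of the imaginary part determine `z₁z̄₂ = ω²`;
  -- interchanging the faces covers the other sign. With `ζ = z₁ω̄` the normals become `ωζ` and
  -- `ω̄ζ`.
  have aux : ∀ z₁ z₂ : ℂ, ‖z₁‖ = 1 → ‖z₂‖ = 1 → (z₁ * conj z₂).re = -Real.cos θ →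
      0 ≤ (z₁ * conj z₂).im → z₂ = z₁ * conj ω * conj ω := by
    intro z₁ z₂ hz₁ hz₂ hz him
    have hn : ‖z₁ * conj z₂‖ = 1 := by simp [hz₁, hz₂]
    have h3 := Complex.sq_norm (z₁ * conj z₂)
    rw [hn, Complex.normSq_apply, hz, hcosθ] at h3
    have him2 : (z₁ * conj z₂).im = 2 * Real.sin (θ / 2) * Real.cos (θ / 2) := by
      refine (sq_eq_sq₀ him (by positivity)).1 ?_
      nlinarith
    have h4 : z₁ * conj z₂ = ω * ω := by
      apply Complex.ext
      · rw [hz, hcosθ, Complex.mul_re]; ring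
      · rw [him2, Complex.mul_im]; ring
    have e1 := conj_mul_self_of_norm_eq_one hz₂
    have e2 : conj z₁ * z₂ = conj ω * conj ω := by
      have := congrArg conj h4
      simpa using this
    linear_combination z₁ * e2 - z₂ * conj_mul_self_of_norm_eq_one hz₁
  obtain ⟨ζ, hζ, k₁, k₂⟩ : ∃ ζ : ℂ, ‖ζ‖ = 1 ∧ FlatDir A (2 * d) (ω * ζ) ∧
      FlatDir A (2 * d) (conj ω * ζ) := by
    rcases le_total 0 (z₁ * conj z₂).im with him | him
    · refine ⟨z₁ * conj ω, by simp [hz₁, hωn], ?_, ?_⟩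
      · convert g₁ using 1
        linear_combination z₁ * hωω
      · convert g₂ using 1
        rw [aux z₁ z₂ hz₁ hz₂ hz him]; ring
    · have e : z₂ * conj z₁ = conj (z₁ * conj z₂) := by simp [mul_comm]
      refine ⟨z₂ * conj ω, by simp [hz₂, hωn], ?_, ?_⟩
      · convert g₂ using 1
        linear_combination z₂ * hωω
      · convert g₁ using 1
        rw [aux z₂ z₁ hz₂ hz₁ (by rw [e, Complex.conj_re, hz])
          (by rw [e, Complex.conj_im]; linarith)]
        ring
  obtain ⟨U, hU, T, hT, rfl⟩ := exists_unitary_strictUpper hA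
  have hζ0 : ζ ≠ 0 := by rintro rfl; simp at hζ
  obtain ⟨V, hV, x, y, δ₁, δ₂, hx, hy, hδ, hTV⟩ := NilpotentNR.exists_hasForm
    (T := ζ • T) (fun i j hij => by simp [hT i j hij]) hd (by nlinarith) hωn rfl hC.ne'
    ((flatDir_smul_iff hζ0).2 (flatDir_unitary_conj hU k₁))
    ((flatDir_smul_iff hζ0).2 (flatDir_unitary_conj hU k₂))
  obtain ⟨t, ht, hexp⟩ := exists_exp_eq (c := conj ζ) (by rw [RCLike.norm_conj, hζ])
  refine ⟨x, y, hx, hy, t, δ₁, δ₂, ht, hδ, U * V, mul_mem hU hV, ?_⟩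
  have hT' : T = conj ζ • (V * formMatrix x y δ₁ δ₂ * star V) := by
    rw [← hTV, smul_smul, conj_mul_self_of_norm_eq_one hζ, one_smul]
  rw [hexp, hT', star_mul]
  simp only [Matrix.mul_smul, Matrix.smul_mul, Matrix.mul_assoc]

theorem FormParams.extremal_gap {x y δ₁ δ₂ k S : ℝ} (h : FormParams x y δ₁ δ₂ k S) :
    k / (2 * (k ^ 2 - S * x * y)) - -(k / (2 * (k ^ 2 + S * x * y))) =
      k ^ 3 / (k ^ 4 - S ^ 2 * x ^ 2 * y ^ 2) := by
  obtain ⟨h1, h2⟩ := h.mul_bounds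
  have e1 : k ^ 2 - S * x * y ≠ 0 := by linarith
  have e2 : k ^ 2 + S * x * y ≠ 0 := by linarith
  have e3 : k ^ 4 - S ^ 2 * x ^ 2 * y ^ 2 = (k ^ 2 - S * x * y) * (k ^ 2 + S * x * y) := by ring
  rw [e3]
  field_simp
  ring

theorem HasForm.hasTwoFlatPortions {θ d x y : ℝ} (hθ : 0 < θ ∧ θ < Real.pi) (hd : 0 < d)
    {A : Matrix (Fin 4) (Fin 4) ℂ} (h : HasForm d θ x y A) :
    HasTwoFlatPortions (numericalRange A) d θ := by
  have hC : 0 < Real.cos (θ / 2) :=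
    Real.cos_pos_of_mem_Ioo ⟨by linarith [hθ.1, Real.pi_pos], by linarith [hθ.2]⟩
  have hSC := Real.sin_sq_add_cos_sq (θ / 2)
  obtain ⟨δ₁, δ₂, hP, c, hc, U, hU, rfl⟩ := h.exists_params hd (by nlinarith)
  have hcosθ : -Real.cos θ = Real.sin (θ / 2) ^ 2 - Real.cos (θ / 2) ^ 2 := by
    have := Real.cos_two_mul (θ / 2)
    rw [mul_div_cancel₀ _ two_ne_zero] at this
    rw [this]; linarith
  set ω : ℂ := ⟨Real.sin (θ / 2), Real.cos (θ / 2)⟩ with hω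
  have hωn : ‖ω‖ = 1 := by
    have : ‖ω‖ ^ 2 = 1 := by
      rw [Complex.sq_norm, Complex.normSq_apply]
      linarith
    exact (pow_eq_one_iff_of_nonneg (norm_nonneg _) two_ne_zero).1 this
  have hcc := conj_mul_self_of_norm_eq_one hc
  have hc0 : c ≠ 0 := by rintro rfl; simp at hc
  have hmul : ∀ z w : ℂ, z * conj c * (c * w) = z * w := fun z w => by
    linear_combination z * w * hcc
  have support : ∀ z : ℂ, ‖z‖ = 1 → z.re = Real.sin (θ / 2) →
      ∀ w ∈ numericalRange (U * (c • formMatrix x y δ₁ δ₂) * star U), -d ≤ (z * conj c * w).re := by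
    intro z hz hre w hw
    obtain ⟨w', hw', rfl⟩ := (numericalRange_unitary_smul hU c _).1 hw
    have := pencil_posSemidef_iff.1 (hP.posSemidef hz hre) w' hw'
    rw [hmul]
    linarith
  have face : ∀ z : ℂ, ‖z‖ = 1 → z.re = Real.sin (θ / 2) → z.im ≠ 0 →
      ∃ a ∈ numericalRange (U * (c • formMatrix x y δ₁ δ₂) * star U),
      ∃ b ∈ numericalRange (U * (c • formMatrix x y δ₁ δ₂) * star U), a ≠ b ∧
        (z * conj c * a).re = -d ∧ (z * conj c * b).re = -d := by
    intro z hz hre him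
    obtain ⟨⟨v, -, hv, hvq⟩, w, -, hw, hwq⟩ := hP.exists_extremal hz hre
    refine ⟨c * quad _ v, (numericalRange_unitary_smul hU c _).2
      ⟨_, mem_numericalRange_iff.2 ⟨v, hv, rfl⟩, rfl⟩, c * quad _ w,
      (numericalRange_unitary_smul hU c _).2
      ⟨_, mem_numericalRange_iff.2 ⟨w, hw, rfl⟩, rfl⟩, ?_, ?_, ?_⟩
    · intro heq
      have heq' := mul_left_cancel₀ hc0 heq
      rw [heq', hwq] at hvq
      have h1 := congrArg Complex.im hvq
      simp only at h1
      have hX : z.im * x * y ≠ 0 := mul_ne_zero (mul_ne_zero him hP.x_pos.ne') hP.y_pos.ne'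
      have h2 := mul_left_cancel₀ hX h1
      obtain ⟨b1, b2⟩ := hP.mul_bounds
      have hk := hP.k_pos
      have p1 : 0 < 2 * d / (2 * ((2 * d) ^ 2 - Real.sin (θ / 2) * x * y)) :=
        div_pos hk (by linarith)
      have p2 : 0 < 2 * d / (2 * ((2 * d) ^ 2 + Real.sin (θ / 2) * x * y)) :=
        div_pos hk (by linarith)
      linarith
    · rw [hmul, hvq]; ring
    · rw [hmul, hwq]; ring
  have hω' : ‖conj ω‖ = 1 := by rw [RCLike.norm_conj, hωn]
  have hcn : ‖conj c‖ = 1 := by rw [RCLike.norm_conj, hc]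
  refine hasTwoFlatPortions_of_support (convex_numericalRange _) (isCompact_numericalRange _) hd hθ
    (z₁ := ω * conj c) (z₂ := conj ω * conj c) (by rw [norm_mul, hωn, hcn, one_mul])
    (by rw [norm_mul, hω', hcn, one_mul]) ?_ (support ω hωn rfl) (support _ hω' rfl)
    (face ω hωn rfl hC.ne') (face _ hω' rfl (neg_ne_zero.2 hC.ne'))
  -- The normals have relative phase `ω²`, whose real part `S² - C²` is `-cos θ`.
  have : ω * conj c * conj (conj ω * conj c) = ω * ω := by
    simp only [map_mul, Complex.conj_conj]
    linear_combination ω * ω * hcc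
  rw [this, hcosθ, Complex.mul_re]
  ring

/-- Uniqueness of the flat direction places the face on a known support line with `|Im| = C`. There
the positions are `X f` with `lo ≤ f ≤ hi` and both ends attained, so the length is `|X| (hi - lo)`.
-/
theorem HasForm.dist_eq {θ d x y : ℝ} (hθ : 0 < θ ∧ θ < Real.pi) (hd : 0 < d)
    {A : Matrix (Fin 4) (Fin 4) ℂ} (h : HasForm d θ x y A) {p q : ℂ}
    (hf : IsFlatPortion (numericalRange A) p q) :
    dist p q = 8 * d ^ 3 * x * y * Real.cos (θ / 2) /
      (16 * d ^ 4 - x ^ 2 * y ^ 2 * Real.sin (θ / 2) ^ 2) := by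
  have hC : 0 < Real.cos (θ / 2) :=
    Real.cos_pos_of_mem_Ioo ⟨by linarith [hθ.1, Real.pi_pos], by linarith [hθ.2]⟩
  have hS : 0 < Real.sin (θ / 2) :=
    Real.sin_pos_of_pos_of_lt_pi (by linarith [hθ.1]) (by linarith [hθ.2, Real.pi_pos])
  have hSC := Real.sin_sq_add_cos_sq (θ / 2)
  obtain ⟨δ₁, δ₂, hP, c, hc, U, hU, rfl⟩ := h.exists_params hd (by nlinarith)
  have hc0 : c ≠ 0 := by rintro rfl; simp at hc
  obtain ⟨z, l, hz, hface⟩ := hf.exists_isFace (convex_numericalRange _)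
    (isCompact_numericalRange _).isClosed
  have hfd := (flatDir_smul_iff hc0).1 (flatDir_unitary_conj hU (hface.flatDir hf.1))
  have hωn : ‖z * c‖ = 1 := by rw [norm_mul, hz, hc, one_mul]
  obtain ⟨hl, hre⟩ := hP.flatDir_unique hS hωn hfd
  obtain rfl : l = -d := by linarith
  have hpsd := hP.posSemidef hωn hre
  have himabs : |(z * c).im| = Real.cos (θ / 2) := by
    have h3 := Complex.sq_norm (z * c)
    rw [hωn, Complex.normSq_apply, hre] at h3
    refine (sq_eq_sq₀ (abs_nonneg _) hC.le).1 ?_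
    rw [sq_abs]; linarith
  set X := (z * c).im * x * y with hX
  have value : ∀ w ∈ numericalRange (U * (c • formMatrix x y δ₁ δ₂) * star U), (z * w).re = -d →
      ∃ f : ℝ, -(2 * d / (2 * ((2 * d) ^ 2 + Real.sin (θ / 2) * x * y))) ≤ f ∧
        f ≤ 2 * d / (2 * ((2 * d) ^ 2 - Real.sin (θ / 2) * x * y)) ∧ (z * w).im = X * f := by
    intro w hw hwl
    obtain ⟨w', hw', rfl⟩ := (numericalRange_unitary_smul hU c _).1 hw
    obtain ⟨v, hv, rfl⟩ := mem_numericalRange_iff.1 hw'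
    rw [← mul_assoc] at hwl
    obtain ⟨f, f1, f2, f3⟩ := hP.values_mem hωn hre
      ((pencil_mulVec_eq_zero_iff hpsd hv).2 (by rw [hwl]; ring)) hv
    exact ⟨f, f1, f2, by rw [← mul_assoc, f3]⟩
  have attained : ∀ v : Fin 4 → ℂ, ∀ f : ℝ, star v ⬝ᵥ v = 1 →
      z * c * quad (formMatrix x y δ₁ δ₂) v = ⟨-(2 * d / 2), X * f⟩ →
      X * f ∈ segment ℝ (z * p).im (z * q).im := by
    intro v f hv hq
    have hmem := (hface.2 (c * quad (formMatrix x y δ₁ δ₂) v)).2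
      ⟨(numericalRange_unitary_smul hU c _).2 ⟨_, mem_numericalRange_iff.2 ⟨v, hv, rfl⟩, rfl⟩, by
        rw [← mul_assoc, hq]; ring⟩
    have := ((mem_segment_of_re_eq hz hface.left_mem.2 hface.right_mem.2).1 hmem).2
    rwa [← mul_assoc, hq] at this
  obtain ⟨fp, p1, p2, p3⟩ := value p hface.left_mem.1 hface.left_mem.2
  obtain ⟨fq, q1, q2, q3⟩ := value q hface.right_mem.1 hface.right_mem.2
  obtain ⟨⟨v, -, hv, hvq⟩, w, -, hw, hwq⟩ := hP.exists_extremal hωn hre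
  have s1 := attained v _ hv hvq
  have s2 := attained w _ hw hwq
  have hgap := hP.extremal_gap
  set hi := 2 * d / (2 * ((2 * d) ^ 2 - Real.sin (θ / 2) * x * y))
  set lo := -(2 * d / (2 * ((2 * d) ^ 2 + Real.sin (θ / 2) * x * y)))
  rw [p3, q3, segment_eq_uIcc] at s1 s2
  have hlo : lo ≤ hi := p1.trans p2
  have hle : |X| * (hi - lo) ≤ |X| * |fp - fq| := by
    rw [← abs_of_nonneg (sub_nonneg.2 hlo), ← abs_mul, ← abs_mul, mul_sub, mul_sub]
    have := Set.abs_sub_le_of_uIcc_subset_uIcc (Set.uIcc_subset_uIcc s2 s1)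
    rwa [abs_sub_comm (X * fq)] at this
  have hge : |fp - fq| ≤ hi - lo := by rw [abs_le]; constructor <;> linarith
  rw [dist_of_re_eq hz (hface.left_mem.2.trans hface.right_mem.2.symm), p3, q3, ← mul_sub, abs_mul,
    le_antisymm (mul_le_mul_of_nonneg_left hge (abs_nonneg X)) hle, hgap, hX, abs_mul, abs_mul,
    himabs, abs_of_pos hP.x_pos, abs_of_pos hP.y_pos]
  rw [mul_div_assoc']
  congr 1 <;> ring

end Main

end NilpotentNR

theorem theorem4p1 (θ d : ℝ) (hθ : 0 < θ ∧ θ < Real.pi) (hd : 0 < d)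
    (A : Matrix (Fin 4) (Fin 4) ℂ) (hA : IsNilpotent A) :
    (NilpotentNR.HasTwoFlatPortions (NilpotentNR.numericalRange A) d θ ↔
      ∃ x y : ℝ, NilpotentNR.HasForm d θ x y A) ∧
    ∀ x y : ℝ, NilpotentNR.HasForm d θ x y A →
      ∀ p q : ℂ, NilpotentNR.IsFlatPortion (NilpotentNR.numericalRange A) p q →
        dist p q = 8 * d ^ 3 * x * y * Real.cos (θ / 2) /
          (16 * d ^ 4 - x ^ 2 * y ^ 2 * Real.sin (θ / 2) ^ 2) :=
  ⟨⟨fun h => h.exists_hasForm hθ hd hA, fun ⟨_, _, h⟩ => h.hasTwoFlatPortions hθ hd⟩,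
    fun _ _ h _ _ hf => h.dist_eq hθ hd hf⟩
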